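/- Let $0<s<1$, let $\mathbf p$ be a probability row vector in $\mathbb R^2$, let $P$ be an irreducible $2\times2$ stochastic matrix with stationary distribution $\boldsymbol\pi_P$, and let $$R=\begin{pmatrix} s&(1-s)\mathbf p\\ \mathbf 0&P\end{pmatrix}.$$ Consider the three-color urn with replacement matrix $R$: the composition after $n$ trials is a random row vector $\mathbf C_n\in\mathbb R^3$, where $\mathbf C_0$ is a non-random probability vector and, for $n\ge 0$, given $\mathbf C_0,\dots,\mathbf C_n$, color $i$ is drawn at trial $n+1$ with probability $C_{n,i}/(n+1)$, in which case $\mathbf C_{n+1}=\mathbf C_n+(\text{row } i \text{ of } R)$. Let $\lambda\neq1$ be the non-principal eigenvalue of $P$ and $\boldsymbol\xi\ne\mathbf 0$ a corresponding column eigenvector, $P\boldsymbol\xi=\lambda\boldsymbol\xi$. Assume that $R$ is diagonalizable, and put $\mathbf v_2=(c,\boldsymbol\xi')'$, where $c=(1-s)\,\mathbf p\boldsymbol\xi/(\lambda-s)$ if $\lambda\ne s$, and $c=0$ if $\lambda=s$; this is an eigenvector of $R$ for the eigenvalue $\lambda$. Let $\boldsymbol\xi^2$ denote the vector of squared coordinates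 of $\boldsymbol\xi$, and let $\Pi_n(\lambda)=\prod_{j=0}^{n-1}\left(1+\frac{\lambda}{j+1}\right)$. Then: (i) If $\lambda<1/2$, then $\mathbf C_n\mathbf v_2/\sqrt n\Rightarrow N\!\left(0,\frac{\lambda^2}{1-2\lambda}\,\boldsymbol\pi_P\boldsymbol\xi^2\right)$. (ii) If $\lambda=1/2$, then $\mathbf C_n\mathbf v_2/\sqrt{n\log n}\Rightarrow N\!\left(0,\lambda^2\,\boldsymbol\pi_P\boldsymbol\xi^2\right)$. (iii) If $\lambda>1/2$, then $\mathbf C_n\mathbf v_2/\Pi_n(\lambda)$ is an $L^2$-bounded martingale with respect to the natural filtration of $(\mathbf C_n)$, and $\mathbf C_n\mathbf v_2/n^\lambda$ converges almost surely to a random variable that is not almost surely constant. Here $\Rightarrow$ is convergence in distribution, and $N(0,0)$ (the case $\lambda=0$) is the point mass at $0$. -/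

import Mathlib

open Matrix MeasureTheory ProbabilityTheory Filter
open scoped Topology NNReal ENNReal

namespace ReducibleUrn

/-- A urn process with colours indexed by `K`, replacement matrix `R` and initial composition `c₀`.
`C n` is the composition after `n` trials and `X n` is the colour of the ball drawn at trial
`n + 1`; the urn then has total content `n + 1`, and, given `C 0, …, C n`, colour `i` is drawn with
probability `C n i / (n + 1)`. When colour `i` is drawn, row `i` of `R` is added to the urn. -/
structure IsUrnProcess {K : Type*} [Fintype K] [MeasurableSpace K]
    {Ω : Type*} [MeasurableSpace Ω] (μ : Measure Ω) (R : Matrix K K ℝ) (c₀ : K → ℝ)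
    (C : ℕ → Ω → K → ℝ) (X : ℕ → Ω → K) : Prop where
  measurable_composition : ∀ n, Measurable (C n)
  measurable_draw : ∀ n, Measurable (X n)
  init : ∀ ω, C 0 ω = c₀
  step : ∀ n ω, C (n + 1) ω = C n ω + R (X n ω)
  draw : ∀ n i,
    μ⟦X n ⁻¹' {i} | Filtration.natural C (fun k => (measurable_composition k).stronglyMeasurable) n⟧
      =ᵐ[μ] fun ω => C n ω i / ((n : ℝ) + 1)

/-- The natural filtration of the sequence of compositions. -/
def IsUrnProcess.filtration {K : Type*} [Fintype K] [MeasurableSpace K]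
    {Ω : Type*} [MeasurableSpace Ω] {μ : Measure Ω} {R : Matrix K K ℝ} {c₀ : K → ℝ}
    {C : ℕ → Ω → K → ℝ} {X : ℕ → Ω → K} (h : IsUrnProcess μ R c₀ C X) :
    Filtration ℕ (inferInstance : MeasurableSpace Ω) :=
  Filtration.natural C (fun k => (h.measurable_composition k).stronglyMeasurable)

/-- The block matrix with rows `(s, (1 - s) p)` and `(0, P)`. -/
def replacementMatrix (s : ℝ) (p : Fin 2 → ℝ) (P : Matrix (Fin 2) (Fin 2) ℝ) :
    Matrix (Fin 3) (Fin 3) ℝ :=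
  !![s, (1 - s) * p 0, (1 - s) * p 1;
     0, P 0 0, P 0 1;
     0, P 1 0, P 1 1]

/-- A square real matrix is diagonalizable if it is similar to a diagonal matrix. -/
def IsDiagonalizable {K : Type*} [Fintype K] [DecidableEq K] (A : Matrix K K ℝ) : Prop :=
  ∃ (T : Matrix K K ℝ) (d : K → ℝ), IsUnit T ∧ A * T = T * diagonal d

open Classical in
/-- The vector `(c, ξ)` with `c = (1 - s) p ξ / (lam - s)` if `lam ≠ s`, and `c = 0` if
`lam = s`. -/
noncomputable def vTwo (s : ℝ) (p : Fin 2 → ℝ) (lam : ℝ) (ξ : Fin 2 → ℝ) : Fin 3 → ℝ :=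
  ![if lam = s then 0 else (1 - s) * (p ⬝ᵥ ξ) / (lam - s), ξ 0, ξ 1]

/-- `∏_{j < n} (1 + lam / (j + 1))`. -/
noncomputable def PiProd (n : ℕ) (lam : ℝ) : ℝ :=
  ∏ j ∈ Finset.range n, (1 + lam / ((j : ℝ) + 1))

/-- Weak convergence of `Y n` to the normal distribution with mean `0` and variance `v`. -/
def ConvergesWeaklyToNormal {Ω : Type*} [MeasurableSpace Ω] (μ : Measure Ω)
    [IsProbabilityMeasure μ] (Y : ℕ → Ω → ℝ) (v : ℝ≥0) : Prop :=
  TendstoInDistribution Y atTop (id : ℝ → ℝ) (fun _ => μ) (gaussianReal 0 v)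

/-- `Y` is non-degenerate: it is not almost surely equal to a constant. -/
def NonDegenerate {Ω : Type*} [MeasurableSpace Ω] (μ : Measure Ω) (Y : Ω → ℝ) : Prop :=
  ¬ ∃ a : ℝ, ∀ᵐ ω ∂μ, Y ω = a

end ReducibleUrn

namespace ReducibleUrn

/-! ### Scalar analysis: products, linear recursions, Taylor bounds -/

section

/-! Since v is a right eigenvector of R, Y_n = C_n v is a scalar process: Y_{n+1} = Y_n + λ v(X_n),
with conditional mean ρ_n Y_n, where ρ_n = 1 + λ/(n+1). Hence Y_n/Π_n(λ) is a martingale when Π_n(λ)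
does not vanish, and the regimes differ by how n^λ compares with √n.

For λ ≤ 1/2 the limit law comes from iterating characteristic functions. Averaging over one draw
(`integral_draw`) gives φ_{n+1}(θ) ≈ φ_n(ρ_n θ) exp(-θ²λ²σ²/2), where σ² is the limiting conditional
variance of a draw. After n steps the Gaussian factor has variance λ²σ²A_n with A_{n+1} = ρ_n² A_n +
1. The comparison `tendsto_div_of_linear_recursion` yields A_n ~ n/(1-2λ), or n log n when λ = 1/2,
and also shows that the accumulated errors are negligible.

The conditional variance converges in mean for three reasons: a second moment bound makes Y_n/(n+1)
small; the share of the first colour has mean of order at most n^(s-1); and on the other two colours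
v takes the values ξ 0, ξ 1, so v² is affine in v there. The limit -(ξ 0 * ξ 1) equals π ξ² because
π ξ = 0.

For λ > 1/2, summability of 1/Π_n(λ)² bounds the martingale in L². It is then closed by its limit; a
constant limit would make every term constant, hence v(X_n) constant, although both colours of the
dominant block have positive probability at the third draw and carry different values of v. -/

theorem PiProd_zero (κ : ℝ) : PiProd 0 κ = 1 := by simp [PiProd]

theorem PiProd_succ (n : ℕ) (κ : ℝ) :
    PiProd (n + 1) κ = (1 + κ / ((n : ℝ) + 1)) * PiProd n κ := by
  rw [PiProd, Finset.prod_range_succ, mul_comm, PiProd]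

theorem PiProd_pos {κ : ℝ} (hκ : 0 ≤ κ) (n : ℕ) : 0 < PiProd n κ :=
  Finset.prod_pos fun j _ => by positivity

theorem one_le_PiProd {κ : ℝ} (hκ : 0 ≤ κ) (n : ℕ) : 1 ≤ PiProd n κ := by
  induction n with
  | zero => rw [PiProd_zero]
  | succ n ih =>
    rw [PiProd_succ]
    have : 0 ≤ κ / ((n : ℝ) + 1) := by positivity
    exact one_le_mul_of_one_le_of_one_le (by linarith) ih

/-- The right side is the denominator of Euler's limit formula for Γ(κ). -/
theorem PiProd_mul_prod (n : ℕ) {κ : ℝ} :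
    κ * PiProd n κ * (n.factorial : ℝ) = ∏ j ∈ Finset.range (n + 1), (κ + j) := by
  induction n with
  | zero => simp [PiProd]
  | succ n ih =>
    rw [Finset.prod_range_succ, ← ih, PiProd_succ, Nat.factorial_succ]
    push_cast
    field_simp
    ring

theorem tendsto_rpow_div_PiProd {κ : ℝ} (hκ : 0 < κ) :
    Tendsto (fun n : ℕ => (n : ℝ) ^ κ / PiProd n κ) atTop (𝓝 (Real.Gamma (κ + 1))) := by
  rw [Real.Gamma_add_one hκ.ne']
  refine ((Real.GammaSeq_tendsto_Gamma κ).const_mul κ).congr fun n => ?_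
  have h1 := (PiProd_pos hκ.le n).ne'
  have h2 : (n.factorial : ℝ) ≠ 0 := by positivity
  rw [Real.GammaSeq, ← PiProd_mul_prod]
  field_simp

/-- Gives the exact order n^κ; the constant 1/Γ(κ+1) converts the martingale normalization into n^λ.
-/
theorem tendsto_PiProd_div_rpow {κ : ℝ} (hκ : 0 < κ) :
    Tendsto (fun n : ℕ => PiProd n κ / (n : ℝ) ^ κ) atTop (𝓝 (Real.Gamma (κ + 1))⁻¹) := by
  refine ((tendsto_rpow_div_PiProd hκ).inv₀ (Real.Gamma_pos_of_pos (by linarith)).ne').congr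
    fun n => ?_
  rw [inv_div]

/-- Comparison of two solutions of linear recursions with the same multipliers. -/
theorem tendsto_div_of_linear_recursion {ρ x w d e q : ℕ → ℝ} {δ η : ℝ}
    (hρ : ∀ n, 0 ≤ ρ n) (hx : ∀ n, x (n + 1) = ρ n * x n + d n)
    (hw : ∀ n, w (n + 1) = ρ n * w n + e n) (hw0 : ∀ᶠ n in atTop, 0 < w n)
    (hd : Tendsto d atTop (𝓝 δ)) (he : Tendsto e atTop (𝓝 η)) (hη : 0 < η)
    (hq0 : ∀ n, 0 < q n) (hq : ∀ n, ρ n * q n ≤ q (n + 1))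
    (hqw : Tendsto (fun n => q n / w n) atTop (𝓝 0)) :
    Tendsto (fun n => x n / w n) atTop (𝓝 (δ / η)) := by
  rw [Metric.tendsto_atTop']
  intro ε hε
  have h1 : Tendsto (fun n => |d n - δ / η * e n| - ε / 2 * e n) atTop (𝓝 (0 - ε / 2 * η)) := by
    refine Tendsto.sub ?_ (he.const_mul _)
    have := (hd.sub (he.const_mul (δ / η))).abs
    rwa [div_mul_cancel₀ _ hη.ne', sub_self, abs_zero] at this
  have h2 : ∀ᶠ n in atTop, |d n - δ / η * e n| - ε / 2 * e n < 0 :=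
    h1.eventually_lt_const (by have := mul_pos hε hη; linarith)
  obtain ⟨N, hN⟩ := eventually_atTop.1 (h2.and hw0)
  set u : ℕ → ℝ := fun n => x n - δ / η * w n with hu
  set K : ℝ := |u N| / q N with hK
  have hK0 : 0 ≤ K := div_nonneg (abs_nonneg _) (hq0 N).le
  -- The difference u obeys the same recursion with source d - (δ/η) e, eventually at most (ε/2) e
  -- in absolute value. So (ε/2) w dominates the source and the supersolution K q of the homogeneous
  -- recursion absorbs the value at N.
  have h3 : ∀ n ≥ N, |u n| ≤ ε / 2 * w n + K * q n := by
    intro n hn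
    induction n, hn using Nat.le_induction with
    | base =>
      rw [hK, div_mul_cancel₀ _ (hq0 N).ne']
      have := mul_pos (half_pos hε) (hN N le_rfl).2
      linarith
    | succ n hn ih =>
      have e1 : u (n + 1) = ρ n * u n + (d n - δ / η * e n) := by
        simp only [hu, hx, hw]; ring
      have e2 := (hN n hn).1
      calc |u (n + 1)| ≤ ρ n * |u n| + |d n - δ / η * e n| := by
            rw [e1]
            refine (abs_add_le _ _).trans ?_
            rw [abs_mul, abs_of_nonneg (hρ n)]
        _ ≤ ρ n * (ε / 2 * w n + K * q n) + ε / 2 * e n := by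
            have := mul_le_mul_of_nonneg_left ih (hρ n)
            linarith
        _ ≤ ε / 2 * w (n + 1) + K * q (n + 1) := by
            have := mul_le_mul_of_nonneg_left (hq n) hK0
            rw [hw]; linarith
  have h4 : ∀ᶠ n in atTop, K * (q n / w n) < ε / 2 := by
    have := hqw.const_mul K
    rw [mul_zero] at this
    exact this.eventually_lt_const (half_pos hε)
  obtain ⟨N', hN'⟩ := eventually_atTop.1 h4
  refine ⟨max N N', fun n hn => ?_⟩
  have hn1 : N ≤ n := (le_max_left _ _).trans hn.le
  have hwn := (hN n hn1).2
  have e3 : x n / w n - δ / η = u n / w n := by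
    simp only [hu]; field_simp
  rw [Real.dist_eq, e3, abs_div, abs_of_pos hwn]
  calc |u n| / w n ≤ (ε / 2 * w n + K * q n) / w n := by gcongr; exact h3 n hn1
    _ = ε / 2 + K * (q n / w n) := by field_simp
    _ < ε := by have := hN' n ((le_max_right _ _).trans hn.le); linarith

theorem tendsto_one_div_nat_add_one : Tendsto (fun n : ℕ => 1 / ((n : ℝ) + 1)) atTop (𝓝 0) :=
  tendsto_one_div_add_atTop_nhds_zero_nat

/-- Measures how far w n = n is from solving the homogeneous variance recursion; the limit is the η
of case (i). -/
theorem tendsto_linear_source (lam : ℝ) :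
    Tendsto (fun n : ℕ => ((n + 1 : ℕ) : ℝ) - (1 + lam / ((n : ℝ) + 1)) ^ 2 * (n : ℝ)) atTop
      (𝓝 (1 - 2 * lam)) := by
  have h := tendsto_one_div_nat_add_one
  have h2 : Tendsto (fun n : ℕ => 1 - 2 * lam * (1 - 1 / ((n : ℝ) + 1))
      - lam ^ 2 * (1 / ((n : ℝ) + 1) - (1 / ((n : ℝ) + 1)) ^ 2)) atTop
      (𝓝 (1 - 2 * lam * (1 - 0) - lam ^ 2 * (0 - 0 ^ 2))) :=
    (tendsto_const_nhds.sub ((tendsto_const_nhds.sub h).const_mul _)).sub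
      ((h.sub (h.pow 2)).const_mul _)
  have e : 1 - 2 * lam * (1 - 0) - lam ^ 2 * (0 - 0 ^ 2) = 1 - 2 * lam := by ring
  rw [e] at h2
  refine h2.congr fun n => ?_
  push_cast
  field_simp
  ring

theorem tendsto_log_div_nat : Tendsto (fun n : ℕ => Real.log n / (n : ℝ)) atTop (𝓝 0) := by
  have := (Real.isLittleO_log_id_atTop.tendsto_div_nhds_zero).comp tendsto_natCast_atTop_atTop
  exact this

/-- At λ = 1/2 the source of w n = n tends to 0; the factor log n restores a positive limit. -/
theorem tendsto_mul_log_source :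
    Tendsto (fun n : ℕ => ((n + 1 : ℕ) : ℝ) * Real.log ((n + 1 : ℕ) : ℝ)
      - (1 + (1 / 2) / ((n : ℝ) + 1)) ^ 2 * ((n : ℝ) * Real.log n)) atTop (𝓝 1) := by
  have h := tendsto_one_div_nat_add_one
  have h1 : Tendsto (fun n : ℕ => (n : ℝ) * Real.log (1 + 1 / (n : ℝ))) atTop (𝓝 1) :=
    (Real.tendsto_mul_log_one_add_div_atTop 1).comp tendsto_natCast_atTop_atTop
  have hi : Tendsto (fun n : ℕ => 1 / (n : ℝ)) atTop (𝓝 0) := tendsto_one_div_atTop_nhds_zero_nat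
  have h2 : Tendsto (fun n : ℕ => (1 + 1 / (n : ℝ)) * ((n : ℝ) * Real.log (1 + 1 / (n : ℝ)))
      + Real.log n / (n : ℝ) * ((1 - 1 / ((n : ℝ) + 1)) -
          (1 - 1 / ((n : ℝ) + 1)) ^ 2 * (1 / 4))) atTop
      (𝓝 ((1 + 0) * 1 + 0 * ((1 - 0) - (1 - 0) ^ 2 * (1 / 4)))) :=
    ((tendsto_const_nhds.add hi).mul h1).add (tendsto_log_div_nat.mul
      ((tendsto_const_nhds.sub h).sub (((tendsto_const_nhds.sub h).pow 2).mul_const _)))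
  have e : (1 + 0) * 1 + 0 * ((1 - 0) - (1 - 0) ^ 2 * (1 / 4)) = (1 : ℝ) := by ring
  rw [e] at h2
  refine h2.congr' ?_
  filter_upwards [eventually_gt_atTop 0] with n hn
  have hn' : (0 : ℝ) < n := by exact_mod_cast hn
  have hl : Real.log ((n + 1 : ℕ) : ℝ) = Real.log n + Real.log (1 + 1 / (n : ℝ)) := by
    rw [← Real.log_mul hn'.ne' (by positivity)]
    congr 1
    push_cast
    field_simp
  rw [hl]
  generalize Real.log (1 + 1 / (n : ℝ)) = a
  generalize Real.log (n : ℝ) = b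
  push_cast
  field_simp
  ring

theorem tendsto_PiProd_div_sqrt {κ : ℝ} (hκ0 : 0 < κ) (hκ : κ < 1 / 2) :
    Tendsto (fun n : ℕ => PiProd n κ / √(n : ℝ)) atTop (𝓝 0) := by
  have h1 : Tendsto (fun n : ℕ => (n : ℝ) ^ (-(1 / 2 - κ))) atTop (𝓝 0) :=
    (tendsto_rpow_neg_atTop (by linarith)).comp tendsto_natCast_atTop_atTop
  have h2 := (tendsto_PiProd_div_rpow hκ0).mul h1
  rw [mul_zero] at h2
  refine h2.congr' ?_
  filter_upwards [eventually_gt_atTop 0] with n hn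
  have hn' : (0 : ℝ) < n := by exact_mod_cast hn
  rw [neg_sub, Real.rpow_sub hn', Real.sqrt_eq_rpow]
  have := (Real.rpow_pos_of_pos hn' κ).ne'
  field_simp

theorem tendsto_PiProd_half_div_sqrt :
    Tendsto (fun n : ℕ => PiProd n (1 / 2) / √((n : ℝ) * Real.log n)) atTop (𝓝 0) := by
  have h1 : Tendsto (fun n : ℕ => (√(Real.log (n : ℝ)))⁻¹) atTop (𝓝 0) :=
    (Real.tendsto_sqrt_atTop.comp
      (Real.tendsto_log_atTop.comp tendsto_natCast_atTop_atTop)).inv_tendsto_atTop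
  have h2 := (tendsto_PiProd_div_rpow (κ := 1 / 2) (by norm_num)).mul h1
  rw [mul_zero] at h2
  refine h2.congr fun n => ?_
  rw [Real.sqrt_mul (Nat.cast_nonneg n), ← Real.sqrt_eq_rpow, div_mul_eq_div_div, div_eq_mul_inv _ (√(Real.log (n : ℝ)))]

/-- For |x| > 1 every term is already at most a multiple of |x|³, so one crude constant makes the
bound valid for all real x. -/
theorem norm_cexp_sub_taylor_two_le (x : ℝ) :
    ‖Complex.exp (x * Complex.I) - (1 + x * Complex.I - (x : ℂ) ^ 2 / 2)‖ ≤ 4 * |x| ^ 3 := by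
  have hx0 := abs_nonneg x
  rcases le_or_gt |x| 1 with hx | hx
  · have h := Complex.exp_bound (x := x * Complex.I) (by simpa using hx) (n := 3) (by norm_num)
    have e : ∑ m ∈ Finset.range 3, ((x : ℂ) * Complex.I) ^ m / (m.factorial : ℂ)
        = 1 + x * Complex.I - (x : ℂ) ^ 2 / 2 := by
      simp [Finset.sum_range_succ, mul_pow]
      ring
    rw [e] at h
    refine h.trans ?_
    simp only [norm_mul, Complex.norm_I, mul_one, Complex.norm_real, Real.norm_eq_abs]
    rw [mul_comm]
    gcongr
    norm_num [Nat.factorial]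
  · have h1 : ‖Complex.exp (x * Complex.I)‖ = 1 := Complex.norm_exp_ofReal_mul_I x
    have h2 : ‖(1 : ℂ) + x * Complex.I - (x : ℂ) ^ 2 / 2‖ ≤ 1 + |x| + |x| ^ 2 / 2 := by
      refine (norm_sub_le _ _).trans (add_le_add ((norm_add_le _ _).trans ?_) ?_) <;> simp
    refine (norm_sub_le _ _).trans ?_
    rw [h1]
    have h3 : |x| ≤ |x| ^ 3 := le_self_pow₀ hx.le (by norm_num)
    have h4 : |x| ^ 2 ≤ |x| ^ 3 := pow_le_pow_right₀ hx.le (by norm_num)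
    have h5 : 1 ≤ |x| ^ 3 := one_le_pow₀ hx.le
    linarith

theorem abs_exp_neg_sq_sub_le {u : ℝ} (hu : 0 ≤ u) :
    |Real.exp (-u ^ 2) - (1 - u ^ 2)| ≤ u ^ 3 := by
  rcases le_or_gt u 1 with h | h
  · have h1 : u ^ 2 ≤ 1 := pow_le_one₀ hu h
    have h2 := Real.norm_exp_sub_one_sub_id_le (x := -u ^ 2)
      (by rw [norm_neg, Real.norm_eq_abs, abs_of_nonneg (by positivity)]; exact h1)
    rw [Real.norm_eq_abs, Real.norm_eq_abs, abs_neg, abs_of_nonneg (sq_nonneg u)] at h2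
    have e : Real.exp (-u ^ 2) - (1 - u ^ 2) = Real.exp (-u ^ 2) - 1 - -u ^ 2 := by ring
    rw [e]
    refine h2.trans ?_
    rw [← pow_mul]
    exact pow_le_pow_of_le_one hu h (by norm_num)
  · have h1 : u ^ 2 ≤ u ^ 3 := pow_le_pow_right₀ h.le (by norm_num)
    have h2 := Real.add_one_le_exp (-u ^ 2)
    have h3 : Real.exp (-u ^ 2) ≤ 1 := Real.exp_le_one_iff.2 (by nlinarith)
    rw [abs_of_nonneg (by linarith)]
    linarith

end

/-! ### Linear algebra of P and of the replacement matrix -/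

section

variable {P : Matrix (Fin 2) (Fin 2) ℝ} {p π ξ : Fin 2 → ℝ} {s lam : ℝ}

/-- If this entry vanished, every power of P would be lower triangular. -/
theorem pos_zero_one_of_isIrreducible (hP : P.IsIrreducible) : 0 < P 0 1 := by
  refine lt_of_le_of_ne (hP.nonneg 0 1) fun h => ?_
  obtain ⟨k, -, hk⟩ := (isIrreducible_iff_exists_pow_pos hP.nonneg).1 hP 0 1
  have : ∀ k : ℕ, (P ^ k) 0 1 = 0 := by
    intro k
    induction k with
    | zero => simp
    | succ k ih => rw [pow_succ, mul_apply, Fin.sum_univ_two, ih, ← h]; ring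
  exact hk.ne' (this k)

theorem pos_one_zero_of_isIrreducible (hP : P.IsIrreducible) : 0 < P 1 0 :=
  pos_zero_one_of_isIrreducible hP.transpose

theorem rowStochastic_two (hP : P ∈ rowStochastic ℝ (Fin 2)) :
    P 0 0 = 1 - P 0 1 ∧ P 1 1 = 1 - P 1 0 := by
  have h0 := sum_row_of_mem_rowStochastic hP 0
  have h1 := sum_row_of_mem_rowStochastic hP 1
  rw [Fin.sum_univ_two] at h0 h1
  exact ⟨by linarith, by linarith⟩

theorem eigen_eqs (hP : P ∈ rowStochastic ℝ (Fin 2)) (hξ : P *ᵥ ξ = lam • ξ) :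
    (1 - P 0 1) * ξ 0 + P 0 1 * ξ 1 = lam * ξ 0 ∧ P 1 0 * ξ 0 + (1 - P 1 0) * ξ 1 = lam * ξ 1 := by
  obtain ⟨h0, h1⟩ := rowStochastic_two hP
  have e0 := congrFun hξ 0
  have e1 := congrFun hξ 1
  simp only [mulVec, dotProduct, Fin.sum_univ_two, Pi.smul_apply, smul_eq_mul, h0, h1] at e0 e1
  exact ⟨e0, e1⟩

theorem eigen_ne (hP : P ∈ rowStochastic ℝ (Fin 2)) (hξ : P *ᵥ ξ = lam • ξ) (hlam : lam ≠ 1)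
    (hξ0 : ξ ≠ 0) : ξ 0 ≠ ξ 1 := by
  intro h
  obtain ⟨e0, -⟩ := eigen_eqs hP hξ
  rw [← h] at e0
  have : (1 - lam) * ξ 0 = 0 := by linear_combination e0
  rcases mul_eq_zero.1 this with h2 | h2
  · exact hlam (by linarith)
  · refine hξ0 (funext fun i => ?_)
    fin_cases i
    · simpa using h2
    · simpa [← h] using h2

theorem eigenvalue_eq (hP : P ∈ rowStochastic ℝ (Fin 2)) (hξ : P *ᵥ ξ = lam • ξ) (hlam : lam ≠ 1)
    (hξ0 : ξ ≠ 0) : lam = 1 - P 0 1 - P 1 0 := by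
  obtain ⟨e0, e1⟩ := eigen_eqs hP hξ
  refine mul_right_cancel₀ (sub_ne_zero.2 (eigen_ne hP hξ hlam hξ0)) ?_
  linear_combination e1 - e0

/-- This is what keeps every multiplier 1 + λ/(n+1) nonnegative, including n = 0. -/
theorem neg_one_le_eigenvalue (hP : P ∈ rowStochastic ℝ (Fin 2)) (hξ : P *ᵥ ξ = lam • ξ)
    (hlam : lam ≠ 1) (hξ0 : ξ ≠ 0) : -1 ≤ lam := by
  rw [eigenvalue_eq hP hξ hlam hξ0]
  have h0 := le_one_of_mem_rowStochastic hP (i := 0) (j := 1)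
  have h1 := le_one_of_mem_rowStochastic hP (i := 1) (j := 0)
  linarith

theorem stationary_dotProduct_eigenvector (hπP : π ᵥ* P = π) (hξ : P *ᵥ ξ = lam • ξ)
    (hlam : lam ≠ 1) : π ⬝ᵥ ξ = 0 := by
  have h : π ⬝ᵥ ξ = lam * (π ⬝ᵥ ξ) := by
    conv_lhs => rw [← hπP, ← dotProduct_mulVec, hξ, dotProduct_smul, smul_eq_mul]
  have : (1 - lam) * (π ⬝ᵥ ξ) = 0 := by linear_combination h
  exact (mul_eq_zero.1 this).resolve_left (sub_ne_zero.2 hlam.symm)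

/-- Both coordinates are roots of (x - ξ 0)(x - ξ 1), so ξ² = (ξ 0 + ξ 1) ξ - ξ 0 ξ 1; integrate
against π. -/
theorem stationary_dotProduct_sq (hπ : π ∈ stdSimplex ℝ (Fin 2)) (h : π ⬝ᵥ ξ = 0) :
    π ⬝ᵥ ξ ^ 2 = -(ξ 0 * ξ 1) := by
  have h1 := hπ.2
  simp only [dotProduct, Fin.sum_univ_two, Pi.pow_apply] at h h1 ⊢
  linear_combination (ξ 0 + ξ 1) * h - ξ 0 * ξ 1 * h1

/-- Diagonalizability forces `p ξ = 0` when the eigenvalues `s` and `lam` coincide. -/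
theorem dotProduct_eq_zero_of_isDiagonalizable (hs1 : s < 1) (hP : P ∈ rowStochastic ℝ (Fin 2))
    (hPirr : P.IsIrreducible) (hξ0 : ξ ≠ 0) (hξ : P *ᵥ ξ = s • ξ)
    (hR : IsDiagonalizable (replacementMatrix s p P)) : p ⬝ᵥ ξ = 0 := by
  by_contra hpξ
  obtain ⟨T, d, hT, hRT⟩ := hR
  obtain ⟨h0, h1⟩ := rowStochastic_two hP
  have hs := eigenvalue_eq hP hξ hs1.ne hξ0
  have ha := pos_zero_one_of_isIrreducible hPirr
  obtain ⟨e0, -⟩ := eigen_eqs hP hξ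
  -- The row vector (0, 1, -1) is a left eigenvector of R for s, so it annihilates columns with
  -- eigenvalue other than s. A column with eigenvalue s has lower part parallel to ξ and orthogonal
  -- to p, hence zero when p ξ ≠ 0. Then T has two equal rows.
  have key : ∀ j, T 1 j = T 2 j := by
    intro j
    have c0 := congrFun (congrFun hRT 0) j
    have c1 := congrFun (congrFun hRT 1) j
    have c2 := congrFun (congrFun hRT 2) j
    rw [mul_diagonal] at c0 c1 c2
    simp only [mul_apply, Fin.sum_univ_three, replacementMatrix, of_apply,
      cons_val_zero, cons_val_one, cons_val, h0, h1] at c0 c1 c2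
    have hd : (d j - s) * (T 1 j - T 2 j) = 0 := by
      rw [hs]; linear_combination c2 - c1
    rcases mul_eq_zero.1 hd with hd | hd
    · have hds : d j = s := by linarith
      rw [hds] at c0 c1 c2
      have hp : p 0 * T 1 j + p 1 * T 2 j = 0 := by
        have : (1 - s) * (p 0 * T 1 j + p 1 * T 2 j) = 0 := by linear_combination c0
        exact (mul_eq_zero.1 this).resolve_left (by linarith)
      have hpar : ξ 0 * T 2 j = ξ 1 * T 1 j := by
        refine mul_left_cancel₀ ha.ne' ?_
        linear_combination ξ 0 * c1 - T 1 j * e0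
      simp only [dotProduct, Fin.sum_univ_two] at hpξ
      have t1 : T 1 j = 0 := by
        refine (mul_eq_zero.1 ?_).resolve_right hpξ
        linear_combination ξ 0 * hp - p 1 * hpar
      have t2 : T 2 j = 0 := by
        refine (mul_eq_zero.1 ?_).resolve_right hpξ
        linear_combination ξ 1 * hp + p 0 * hpar
      rw [t1, t2]
    · linarith
  exact ((isUnit_iff_isUnit_det T).1 hT).ne_zero
    (det_zero_of_row_eq (i := 1) (j := 2) (by decide) (funext key))

/-- The top coordinate requires (λ - s) c = (1 - s) p ξ, which fixes c unless λ = s; then it needs p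
ξ = 0, supplied by diagonalizability. -/
theorem replacementMatrix_mulVec_vTwo (hs1 : s < 1) (hP : P ∈ rowStochastic ℝ (Fin 2))
    (hPirr : P.IsIrreducible) (hξ0 : ξ ≠ 0) (hξ : P *ᵥ ξ = lam • ξ)
    (hR : IsDiagonalizable (replacementMatrix s p P)) :
    replacementMatrix s p P *ᵥ vTwo s p lam ξ = lam • vTwo s p lam ξ := by
  obtain ⟨h0, h1⟩ := rowStochastic_two hP
  obtain ⟨e0, e1⟩ := eigen_eqs hP hξ
  funext i
  fin_cases i
  · simp only [mulVec, dotProduct, Fin.sum_univ_three, replacementMatrix, vTwo]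
    by_cases h : lam = s
    · subst h
      have := dotProduct_eq_zero_of_isDiagonalizable hs1 hP hPirr hξ0 hξ hR
      simp only [dotProduct, Fin.sum_univ_two] at this
      simp
      linear_combination (1 - lam) * this
    · have : lam - s ≠ 0 := sub_ne_zero.2 h
      simp [h]
      field_simp
      ring
  · simp [mulVec, dotProduct, Fin.sum_univ_three, replacementMatrix, vTwo, h0, h1]
    linear_combination e0
  · simp [mulVec, dotProduct, Fin.sum_univ_three, replacementMatrix, vTwo, h0, h1]
    linear_combination e1

theorem replacementMatrix_mem_rowStochastic (hs0 : 0 < s) (hs1 : s < 1)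
    (hp : p ∈ stdSimplex ℝ (Fin 2)) (hP : P ∈ rowStochastic ℝ (Fin 2)) :
    replacementMatrix s p P ∈ rowStochastic ℝ (Fin 3) := by
  obtain ⟨h0, h1⟩ := rowStochastic_two hP
  have hnn := fun i j => nonneg_of_mem_rowStochastic hP (i := i) (j := j)
  have hp2 := hp.2
  rw [Fin.sum_univ_two] at hp2
  refine mem_rowStochastic_iff_sum.2 ⟨fun i j => ?_, fun i => ?_⟩
  · have := mul_nonneg (sub_nonneg.2 hs1.le) (hp.1 0)
    have := mul_nonneg (sub_nonneg.2 hs1.le) (hp.1 1)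
    clear h0 h1
    fin_cases i <;> fin_cases j <;> simp [replacementMatrix, hs0.le, *]
  · fin_cases i <;> simp [replacementMatrix, Fin.sum_univ_three, h0, h1]
    linear_combination (1 - s) * hp2

end

/-! ### One draw: Gaussian comparison and averaging over the colour -/

section

variable {K : Type*} [Fintype K]

theorem abs_dotProduct_le_of_mem_stdSimplex {x v : K → ℝ} {B : ℝ} (hx : x ∈ stdSimplex ℝ K)
    (hv : ∀ i, |v i| ≤ B) : |x ⬝ᵥ v| ≤ B := by
  calc |x ⬝ᵥ v| ≤ ∑ i, |x i * v i| := Finset.abs_sum_le_sum_abs _ _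
    _ ≤ ∑ i, x i * B := Finset.sum_le_sum fun i _ => by
        rw [abs_mul, abs_of_nonneg (hx.1 i)]
        exact mul_le_mul_of_nonneg_left (hv i) (hx.1 i)
    _ = B := by rw [← Finset.sum_mul, hx.2, one_mul]

/-- Second order expansion of the characteristic function of a finitely supported law, compared
with a Gaussian one. -/
theorem norm_sum_mul_cexp_sub_le {x v : K → ℝ} {B σ2 : ℝ} (hx : x ∈ stdSimplex ℝ K)
    (hv : ∀ i, |v i| ≤ B) (hσ : 0 ≤ σ2) (t : ℝ) :
    ‖∑ i, (x i : ℂ) * Complex.exp ((t * v i : ℝ) * Complex.I)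
        - Complex.exp ((t * (x ⬝ᵥ v) : ℝ) * Complex.I) * (Real.exp (-(t ^ 2 * (σ2 / 2))) : ℝ)‖
      ≤ t ^ 2 / 2 * |∑ i, x i * v i ^ 2 - (x ⬝ᵥ v) ^ 2 - σ2|
        + |t| ^ 3 * (32 * B ^ 3 + √(σ2 / 2) ^ 3) := by
  set z := x ⬝ᵥ v with hz
  set V := ∑ i, x i * v i ^ 2 - z ^ 2 with hV
  have hzB : |z| ≤ B := abs_dotProduct_le_of_mem_stdSimplex hx hv
  have hB : 0 ≤ B := (abs_nonneg z).trans hzB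
  -- Centring removes the first-order term and leaves t² V as second moment.
  set y : K → ℝ := fun i => t * (v i - z) with hy
  have hsum : ∑ i, x i = 1 := hx.2
  have m1 : ∑ i, x i * y i = 0 := by
    have : ∑ i, x i * y i = t * (∑ i, x i * v i - z * ∑ i, x i) := by
      rw [Finset.mul_sum (s := Finset.univ) (a := z), ← Finset.sum_sub_distrib, Finset.mul_sum]
      exact Finset.sum_congr rfl fun i _ => by simp only [hy]; ring
    rw [this, hsum, hz, dotProduct]; ring
  have m2 : ∑ i, x i * y i ^ 2 = t ^ 2 * V := by
    have : ∑ i, x i * y i ^ 2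
        = t ^ 2 * (∑ i, x i * v i ^ 2 - 2 * z * ∑ i, x i * v i + z ^ 2 * ∑ i, x i) := by
      rw [Finset.mul_sum (s := Finset.univ) (a := z ^ 2),
        Finset.mul_sum (s := Finset.univ) (a := 2 * z), ← Finset.sum_sub_distrib,
        ← Finset.sum_add_distrib, Finset.mul_sum]
      exact Finset.sum_congr rfl fun i _ => by simp only [hy]; ring
    have hz' : ∑ i, x i * v i = z := rfl
    rw [this, hsum, hz', hV]; ring
  have hT : ∑ i, (x i : ℂ) * (1 + y i * Complex.I - (y i : ℂ) ^ 2 / 2)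
      = ((1 - t ^ 2 * V / 2 : ℝ) : ℂ) := by
    have : ∑ i, (x i : ℂ) * (1 + y i * Complex.I - (y i : ℂ) ^ 2 / 2)
        = ((∑ i, x i : ℝ) : ℂ) + ((∑ i, x i * y i : ℝ) : ℂ) * Complex.I
          - ((∑ i, x i * y i ^ 2 : ℝ) : ℂ) / 2 := by
      push_cast
      rw [Finset.sum_mul, Finset.sum_div, ← Finset.sum_add_distrib, ← Finset.sum_sub_distrib]
      exact Finset.sum_congr rfl fun i _ => by ring
    rw [this, hsum, m1, m2]
    push_cast
    ring
  set u : ℝ := |t| * √(σ2 / 2) with hu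
  have hu2 : u ^ 2 = t ^ 2 * (σ2 / 2) := by
    rw [hu, mul_pow, sq_abs, Real.sq_sqrt (by linarith)]
  have hexp := abs_exp_neg_sq_sub_le (u := u) (by positivity)
  -- With the phase of the mean factored out, three errors remain: the Taylor remainder of the law,
  -- the variance mismatch V - σ2, and the Taylor remainder of the Gaussian factor.
  have hfac : ∑ i, (x i : ℂ) * Complex.exp ((t * v i : ℝ) * Complex.I)
      - Complex.exp ((t * z : ℝ) * Complex.I) * (Real.exp (-(t ^ 2 * (σ2 / 2))) : ℝ)
      = Complex.exp ((t * z : ℝ) * Complex.I) *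
        (∑ i, (x i : ℂ) * (Complex.exp (y i * Complex.I)
            - (1 + y i * Complex.I - (y i : ℂ) ^ 2 / 2))
          + ((t ^ 2 / 2 * -(V - σ2) : ℝ) : ℂ)
          - ((Real.exp (-u ^ 2) - (1 - u ^ 2) : ℝ) : ℂ)) := by
    have e1 : ∑ i, (x i : ℂ) * (Complex.exp (y i * Complex.I)
            - (1 + y i * Complex.I - (y i : ℂ) ^ 2 / 2))
        = ∑ i, (x i : ℂ) * Complex.exp (y i * Complex.I) - ((1 - t ^ 2 * V / 2 : ℝ) : ℂ) := by
      rw [← hT, ← Finset.sum_sub_distrib]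
      exact Finset.sum_congr rfl fun i _ => by ring
    have e2 : ∑ i, (x i : ℂ) * Complex.exp ((t * v i : ℝ) * Complex.I)
        = Complex.exp ((t * z : ℝ) * Complex.I)
          * ∑ i, (x i : ℂ) * Complex.exp (y i * Complex.I) := by
      rw [Finset.mul_sum]
      refine Finset.sum_congr rfl fun i _ => ?_
      have : ((t * v i : ℝ) : ℂ) * Complex.I
          = ((t * z : ℝ) : ℂ) * Complex.I + y i * Complex.I := by
        simp only [hy]; push_cast; ring
      rw [this, Complex.exp_add]; ring
    rw [e1, e2, hu2, ← mul_sub]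
    congr 1
    push_cast
    ring
  rw [hfac, norm_mul, Complex.norm_exp_ofReal_mul_I, one_mul]
  refine (norm_sub_le _ _).trans ((add_le_add (norm_add_le _ _) le_rfl).trans ?_)
  rw [Complex.norm_real, Complex.norm_real, Real.norm_eq_abs, Real.norm_eq_abs, abs_mul, abs_neg,
    abs_of_nonneg (show 0 ≤ t ^ 2 / 2 by positivity)]
  -- The constant 32 is 4 · 2³: Taylor constant 4 and |v i - z| ≤ 2 B.
  have b1 : ‖∑ i, (x i : ℂ) * (Complex.exp (y i * Complex.I)
            - (1 + y i * Complex.I - (y i : ℂ) ^ 2 / 2))‖ ≤ |t| ^ 3 * (32 * B ^ 3) := by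
    refine (norm_sum_le _ _).trans ?_
    calc _ ≤ ∑ i, x i * (|t| ^ 3 * (32 * B ^ 3)) := Finset.sum_le_sum fun i _ => by
          rw [norm_mul, Complex.norm_real, Real.norm_eq_abs, abs_of_nonneg (hx.1 i)]
          refine mul_le_mul_of_nonneg_left ?_ (hx.1 i)
          refine (norm_cexp_sub_taylor_two_le (y i)).trans ?_
          have : |y i| ≤ |t| * (2 * B) := by
            rw [hy, abs_mul]
            refine mul_le_mul_of_nonneg_left ?_ (abs_nonneg t)
            exact (abs_sub _ _).trans (by have := hv i; linarith)
          calc 4 * |y i| ^ 3 ≤ 4 * (|t| * (2 * B)) ^ 3 := by gcongr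
            _ = |t| ^ 3 * (32 * B ^ 3) := by ring
      _ = _ := by rw [← Finset.sum_mul, hsum, one_mul]
  have hu3 : u ^ 3 = |t| ^ 3 * √(σ2 / 2) ^ 3 := by rw [hu, mul_pow]
  rw [hu3] at hexp
  linarith

variable {Ω : Type*} {C : ℕ → Ω → K → ℝ}

/-- The composition of the urn after `n` trials, normalized to total content `1`. -/
noncomputable def proportion (C : ℕ → Ω → K → ℝ) (n : ℕ) (ω : Ω) : K → ℝ :=
  fun i => C n ω i / ((n : ℝ) + 1)

theorem proportion_dotProduct (n : ℕ) (ω : Ω) (v : K → ℝ) :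
    proportion C n ω ⬝ᵥ v = (C n ω ⬝ᵥ v) / ((n : ℝ) + 1) := by
  simp only [proportion, dotProduct, Finset.sum_div, div_mul_eq_mul_div]

variable [MeasurableSpace K] [MeasurableSpace Ω] {μ : Measure Ω}
  {R : Matrix K K ℝ} {c₀ : K → ℝ} {X : ℕ → Ω → K}

namespace IsUrnProcess

theorem stronglyMeasurable_composition (h : IsUrnProcess μ R c₀ C X) (n : ℕ) :
    StronglyMeasurable[h.filtration n] (C n) :=
  Filtration.stronglyAdapted_natural (fun k => (h.measurable_composition k).stronglyMeasurable) n

theorem stronglyMeasurable_dotProduct (h : IsUrnProcess μ R c₀ C X) (n : ℕ) (v : K → ℝ) :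
    StronglyMeasurable[h.filtration n] (fun ω => C n ω ⬝ᵥ v) :=
  Continuous.comp_stronglyMeasurable (g := fun c : K → ℝ => c ⬝ᵥ v)
    (by unfold dotProduct; fun_prop) (h.stronglyMeasurable_composition n)

theorem measurable_dotProduct (h : IsUrnProcess μ R c₀ C X) (n : ℕ) (v : K → ℝ) :
    Measurable (fun ω => C n ω ⬝ᵥ v) :=
  ((h.stronglyMeasurable_dotProduct n v).mono (h.filtration.le n)).measurable

theorem stronglyMeasurable_proportion (h : IsUrnProcess μ R c₀ C X) (n : ℕ) (i : K) :
    StronglyMeasurable[h.filtration n] (fun ω => proportion C n ω i) :=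
  Continuous.comp_stronglyMeasurable (g := fun c : K → ℝ => c i / ((n : ℝ) + 1))
    (by fun_prop) (h.stronglyMeasurable_composition n)

theorem measurable_proportion (h : IsUrnProcess μ R c₀ C X) (n : ℕ) (i : K) :
    Measurable (fun ω => proportion C n ω i) :=
  ((h.stronglyMeasurable_proportion n i).mono (h.filtration.le n)).measurable

theorem composition_nonneg (h : IsUrnProcess μ R c₀ C X) (hR : ∀ i j, 0 ≤ R i j)
    (hc : ∀ i, 0 ≤ c₀ i) (n : ℕ) (ω : Ω) (i : K) : 0 ≤ C n ω i := by
  induction n with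
  | zero => rw [h.init]; exact hc i
  | succ n ih => rw [h.step]; exact add_nonneg ih (hR _ _)

theorem sum_composition (h : IsUrnProcess μ R c₀ C X) (hR : ∀ i, ∑ j, R i j = 1)
    (hc : ∑ i, c₀ i = 1) (n : ℕ) (ω : Ω) : ∑ i, C n ω i = (n : ℝ) + 1 := by
  induction n with
  | zero => rw [h.init, hc]; simp
  | succ n ih =>
    rw [h.step]
    simp only [Pi.add_apply, Finset.sum_add_distrib, ih, hR]
    push_cast; ring

theorem dotProduct_succ (h : IsUrnProcess μ R c₀ C X) (n : ℕ) (ω : Ω) (v : K → ℝ) :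
    C (n + 1) ω ⬝ᵥ v = C n ω ⬝ᵥ v + (R *ᵥ v) (X n ω) := by
  rw [h.step, add_dotProduct]; rfl

variable [DecidableEq K]

theorem proportion_mem (h : IsUrnProcess μ R c₀ C X) (hR : R ∈ rowStochastic ℝ K)
    (hc : c₀ ∈ stdSimplex ℝ K) (n : ℕ) (ω : Ω) : proportion C n ω ∈ stdSimplex ℝ K := by
  refine ⟨fun i => div_nonneg (h.composition_nonneg hR.1 hc.1 n ω i) (by positivity), ?_⟩
  simp only [proportion]
  rw [← Finset.sum_div, h.sum_composition (fun i => sum_row_of_mem_rowStochastic hR i) hc.2]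
  exact div_self (by positivity)

theorem abs_dotProduct_le (h : IsUrnProcess μ R c₀ C X) (hR : R ∈ rowStochastic ℝ K)
    (hc : c₀ ∈ stdSimplex ℝ K) {v : K → ℝ} {B : ℝ} (hv : ∀ i, |v i| ≤ B) (n : ℕ) (ω : Ω) :
    |C n ω ⬝ᵥ v| ≤ B * ((n : ℝ) + 1) := by
  have := abs_dotProduct_le_of_mem_stdSimplex (h.proportion_mem hR hc n ω) hv
  rwa [proportion_dotProduct, abs_div, abs_of_pos (show (0 : ℝ) < (n : ℝ) + 1 by positivity),
    div_le_iff₀ (by positivity)] at this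

variable [MeasurableSingletonClass K] [IsProbabilityMeasure μ]

/-- Averaging over the colour drawn at trial `n + 1`, given the past. -/
theorem integral_draw (h : IsUrnProcess μ R c₀ C X) (hR : R ∈ rowStochastic ℝ K)
    (hc : c₀ ∈ stdSimplex ℝ K) {E : Type*} [NormedAddCommGroup E] [NormedSpace ℝ E]
    [CompleteSpace E] (n : ℕ) (G : K → Ω → E) (hG : ∀ i, StronglyMeasurable[h.filtration n] (G i))
    (hB : ∀ i, ∃ B, ∀ ω, ‖G i ω‖ ≤ B) :
    ∫ ω, G (X n ω) ω ∂μ = ∫ ω, ∑ i, proportion C n ω i • G i ω ∂μ := by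
  have hGi : ∀ i, Integrable (G i) μ := fun i => by
    obtain ⟨B, hB⟩ := hB i
    exact Integrable.of_bound ((hG i).mono (h.filtration.le n)).aestronglyMeasurable B
      (ae_of_all _ hB)
  have hms : ∀ i, MeasurableSet (X n ⁻¹' {i}) := fun i =>
    h.measurable_draw n (measurableSet_singleton i)
  have hind : ∀ i, Integrable ((X n ⁻¹' {i}).indicator fun _ => (1 : ℝ)) μ := fun i =>
    (integrable_const 1).indicator (hms i)
  have hsm : ∀ i, ((X n ⁻¹' {i}).indicator (fun _ => (1 : ℝ))) • G i
      = (X n ⁻¹' {i}).indicator (G i) := fun i => by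
    funext ω
    by_cases hω : ω ∈ X n ⁻¹' {i} <;> simp [Set.indicator, hω]
  have hint : ∀ i, Integrable (((X n ⁻¹' {i}).indicator (fun _ => (1 : ℝ))) • G i) μ := fun i => by
    rw [hsm]; exact (hGi i).indicator (hms i)
  have hint2 : ∀ i, Integrable (fun ω => proportion C n ω i • G i ω) μ := fun i => by
    obtain ⟨B, hB⟩ := hB i
    refine (hGi i).bdd_smul (C := 1) ?_ (ae_of_all _ fun ω => ?_)
    · exact (h.measurable_proportion n i).aestronglyMeasurable
    · have hm := h.proportion_mem hR hc n ω
      rw [Real.norm_eq_abs, abs_of_nonneg (hm.1 i), ← hm.2]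
      exact Finset.single_le_sum (fun j _ => hm.1 j) (Finset.mem_univ i)
  -- Splitting by the drawn colour leaves indicators times factors known at time n, which pull out
  -- of the conditional expectation.
  have hdec : (fun ω => G (X n ω) ω)
      = fun ω => ∑ i, (((X n ⁻¹' {i}).indicator (fun _ => (1 : ℝ))) • G i) ω := by
    funext ω
    rw [Finset.sum_eq_single (X n ω)]
    · simp [Set.indicator]
    · intro i _ hi
      simp [Set.indicator, hi.symm]
    · simp
  rw [hdec, integral_finsetSum _ fun i _ => hint i, integral_finsetSum _ fun i _ => hint2 i]
  refine Finset.sum_congr rfl fun i _ => ?_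
  rw [← integral_condExp (h.filtration.le n)]
  refine integral_congr_ae ?_
  filter_upwards [condExp_smul_of_aestronglyMeasurable_right (m := h.filtration n) (hind i)
    (hint i) (hG i).aestronglyMeasurable, h.draw n i] with ω h1 h2
  rw [h1, Pi.smul_apply']
  congr 1

end IsUrnProcess

end

/-! ### Recursions for moments and characteristic functions -/

section

/-- The solution of `x (n + 1) = (1 + lam / (n + 1)) ^ 2 * x n + d n` with `x 0 = 0`. -/
noncomputable def varianceRec (lam : ℝ) (d : ℕ → ℝ) : ℕ → ℝ
  | 0 => 0
  | n + 1 => (1 + lam / ((n : ℝ) + 1)) ^ 2 * varianceRec lam d n + d n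

theorem varianceRec_succ (lam : ℝ) (d : ℕ → ℝ) (n : ℕ) :
    varianceRec lam d (n + 1) = (1 + lam / ((n : ℝ) + 1)) ^ 2 * varianceRec lam d n + d n := rfl

theorem varianceRec_one_nonneg (lam : ℝ) (n : ℕ) : 0 ≤ varianceRec lam (fun _ => 1) n := by
  induction n with
  | zero => exact le_rfl
  | succ n ih => rw [varianceRec_succ]; positivity

theorem multiplier_nonneg {lam : ℝ} (h : -1 ≤ lam) (n : ℕ) : 0 ≤ 1 + lam / ((n : ℝ) + 1) := by
  have : (0 : ℝ) < (n : ℝ) + 1 := by positivity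
  have h2 : -1 ≤ lam / ((n : ℝ) + 1) := by
    rw [le_div_iff₀ this]
    have : (0 : ℝ) ≤ n := Nat.cast_nonneg n
    linarith
  linarith

theorem abs_PiProd_le {lam κ : ℝ} (h : -1 ≤ lam) (hκ : lam ≤ κ) (n : ℕ) :
    |PiProd n lam| ≤ PiProd n κ := by
  rw [PiProd, PiProd, Finset.abs_prod]
  refine Finset.prod_le_prod (fun _ _ => abs_nonneg _) fun j _ => ?_
  rw [abs_of_nonneg (multiplier_nonneg h j)]
  gcongr

theorem exists_abs_le {K : Type*} [Fintype K] (v : K → ℝ) : ∃ B, ∀ i, |v i| ≤ B :=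
  ⟨∑ i, |v i|, fun i => Finset.single_le_sum (f := fun i => |v i|) (fun _ _ => abs_nonneg _)
    (Finset.mem_univ i)⟩

variable {K : Type*} [Fintype K] [MeasurableSpace K] {Ω : Type*} [MeasurableSpace Ω] {μ : Measure Ω}
  {R : Matrix K K ℝ} {c₀ : K → ℝ} {C : ℕ → Ω → K → ℝ} {X : ℕ → Ω → K} {v : K → ℝ} {B lam : ℝ}

/-- Characteristic function of `C n ⬝ᵥ v`. -/
noncomputable def charDot (μ : Measure Ω) (C : ℕ → Ω → K → ℝ) (v : K → ℝ) (n : ℕ) (θ : ℝ) : ℂ :=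
  ∫ ω, Complex.exp ((θ * (C n ω ⬝ᵥ v) : ℝ) * Complex.I) ∂μ

/-- Conditional variance of `v` at the colour drawn at trial `n + 1`, given the past. -/
noncomputable def drawVariance (C : ℕ → Ω → K → ℝ) (v : K → ℝ) (n : ℕ) (ω : Ω) : ℝ :=
  ∑ i, proportion C n ω i * v i ^ 2 - (proportion C n ω ⬝ᵥ v) ^ 2

namespace IsUrnProcess

theorem measurable_drawVariance (h : IsUrnProcess μ R c₀ C X) (n : ℕ) (v : K → ℝ) : Measurable (drawVariance C v n) := by
  unfold drawVariance
  refine Measurable.sub (Finset.measurable_sum _ fun i _ =>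
    (h.measurable_proportion n i).mul_const _) (Measurable.pow_const ?_ 2)
  simp only [proportion_dotProduct]
  exact (h.measurable_dotProduct n v).div_const _

variable [DecidableEq K] [IsProbabilityMeasure μ]

theorem integrable_dotProduct (h : IsUrnProcess μ R c₀ C X) (hR : R ∈ rowStochastic ℝ K)
    (hc : c₀ ∈ stdSimplex ℝ K) (n : ℕ) (v : K → ℝ) : Integrable (fun ω => C n ω ⬝ᵥ v) μ := by
  obtain ⟨B, hv⟩ := exists_abs_le v
  exact Integrable.of_bound (h.measurable_dotProduct n v).aestronglyMeasurable _
    (ae_of_all _ (h.abs_dotProduct_le hR hc hv n))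

theorem integrable_dotProduct_sq (h : IsUrnProcess μ R c₀ C X) (hR : R ∈ rowStochastic ℝ K)
    (hc : c₀ ∈ stdSimplex ℝ K) (n : ℕ) (v : K → ℝ) :
    Integrable (fun ω => (C n ω ⬝ᵥ v) ^ 2) μ := by
  obtain ⟨B, hv⟩ := exists_abs_le v
  refine Integrable.of_bound ((h.measurable_dotProduct n v).pow_const 2).aestronglyMeasurable
    ((B * ((n : ℝ) + 1)) ^ 2) (ae_of_all _ fun ω => ?_)
  rw [Real.norm_eq_abs, abs_pow]
  exact pow_le_pow_left₀ (abs_nonneg _) (h.abs_dotProduct_le hR hc hv n ω) 2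

theorem integrable_drawVariance (h : IsUrnProcess μ R c₀ C X) (hR : R ∈ rowStochastic ℝ K)
    (hc : c₀ ∈ stdSimplex ℝ K) (n : ℕ) (v : K → ℝ) : Integrable (drawVariance C v n) μ := by
  obtain ⟨B, hv⟩ := exists_abs_le v
  obtain ⟨B', hv'⟩ := exists_abs_le (v ^ 2)
  refine Integrable.of_bound (h.measurable_drawVariance n v).aestronglyMeasurable (B' + B ^ 2)
    (ae_of_all _ fun ω => ?_)
  have hm := h.proportion_mem hR hc n ω
  refine (abs_sub _ _).trans (add_le_add ?_ ?_)
  · exact abs_dotProduct_le_of_mem_stdSimplex hm hv'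
  · rw [abs_pow]
    exact pow_le_pow_left₀ (abs_nonneg _) (abs_dotProduct_le_of_mem_stdSimplex hm hv) 2

variable [MeasurableSingletonClass K]

theorem integral_dotProduct_succ (h : IsUrnProcess μ R c₀ C X) (hR : R ∈ rowStochastic ℝ K)
    (hc : c₀ ∈ stdSimplex ℝ K) (n : ℕ) (v : K → ℝ) :
    ∫ ω, C (n + 1) ω ⬝ᵥ v ∂μ
      = ∫ ω, C n ω ⬝ᵥ v ∂μ + (∫ ω, C n ω ⬝ᵥ (R *ᵥ v) ∂μ) / ((n : ℝ) + 1) := by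
  have hd := h.integral_draw hR hc n (fun i ω => (R *ᵥ v) i)
    (fun i => stronglyMeasurable_const) (fun i => ⟨_, fun ω => le_rfl⟩)
  have e : ∀ ω, ∑ i, proportion C n ω i • (R *ᵥ v) i = (C n ω ⬝ᵥ (R *ᵥ v)) / ((n : ℝ) + 1) :=
    fun ω => proportion_dotProduct n ω _
  simp only [e] at hd
  have hi : Integrable (fun ω => (R *ᵥ v) (X n ω)) μ := by
    have : (fun ω => (R *ᵥ v) (X n ω)) = fun ω => C (n + 1) ω ⬝ᵥ v - C n ω ⬝ᵥ v := by
      funext ω; rw [h.dotProduct_succ]; ring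
    rw [this]
    exact (h.integrable_dotProduct hR hc _ v).sub (h.integrable_dotProduct hR hc _ v)
  simp only [h.dotProduct_succ]
  rw [integral_add (h.integrable_dotProduct hR hc _ v) hi, hd, integral_div]

theorem integral_dotProduct_eigenvector (h : IsUrnProcess μ R c₀ C X) (hR : R ∈ rowStochastic ℝ K)
    (hc : c₀ ∈ stdSimplex ℝ K) (hv : R *ᵥ v = lam • v) (n : ℕ) :
    ∫ ω, C n ω ⬝ᵥ v ∂μ = PiProd n lam * (c₀ ⬝ᵥ v) := by
  induction n with
  | zero => simp [h.init, PiProd_zero]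
  | succ n ih =>
    rw [h.integral_dotProduct_succ hR hc, hv]
    simp only [dotProduct_smul, smul_eq_mul]
    rw [integral_const_mul, ih, PiProd_succ]
    ring

/-- Expanding the square gives y²(1 + 2λ/(n+1)) plus λ² times the conditional second moment of v;
adding (λ y/(n+1))² completes the square, matching `varianceRec` at the cost of equality. -/
theorem integral_dotProduct_sq_succ_le (h : IsUrnProcess μ R c₀ C X) (hR : R ∈ rowStochastic ℝ K)
    (hc : c₀ ∈ stdSimplex ℝ K) (hv : R *ᵥ v = lam • v) (hB : ∀ i, |v i| ≤ B) (n : ℕ) :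
    ∫ ω, (C (n + 1) ω ⬝ᵥ v) ^ 2 ∂μ
      ≤ (1 + lam / ((n : ℝ) + 1)) ^ 2 * ∫ ω, (C n ω ⬝ᵥ v) ^ 2 ∂μ + lam ^ 2 * B ^ 2 := by
  have hd := h.integral_draw hR hc n (fun i ω => (C n ω ⬝ᵥ v + lam * v i) ^ 2)
    (fun i => ((h.stronglyMeasurable_dotProduct n v).add stronglyMeasurable_const).pow 2)
    (fun i => ⟨(B * ((n : ℝ) + 1) + |lam| * B) ^ 2, fun ω => by
      rw [Real.norm_eq_abs, abs_pow]
      refine pow_le_pow_left₀ (abs_nonneg _) ((abs_add_le _ _).trans ?_) 2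
      refine add_le_add (h.abs_dotProduct_le hR hc hB n ω) ?_
      rw [abs_mul]
      exact mul_le_mul_of_nonneg_left (hB i) (abs_nonneg _)⟩)
  have e : ∀ ω, C (n + 1) ω ⬝ᵥ v = C n ω ⬝ᵥ v + lam * v (X n ω) := fun ω => by
    rw [h.dotProduct_succ, hv]; rfl
  simp only [e]
  rw [hd]
  have hle : ∀ ω, ∑ i, proportion C n ω i • (C n ω ⬝ᵥ v + lam * v i) ^ 2
      ≤ (1 + lam / ((n : ℝ) + 1)) ^ 2 * (C n ω ⬝ᵥ v) ^ 2 + lam ^ 2 * B ^ 2 := by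
    intro ω
    have hm := h.proportion_mem hR hc n ω
    have hz := proportion_dotProduct (C := C) n ω v
    set y := C n ω ⬝ᵥ v
    have e1 : ∑ i, proportion C n ω i • (y + lam * v i) ^ 2
        = y ^ 2 * ∑ i, proportion C n ω i + 2 * lam * y * (proportion C n ω ⬝ᵥ v)
          + lam ^ 2 * ∑ i, proportion C n ω i * v i ^ 2 := by
      rw [dotProduct, Finset.mul_sum, Finset.mul_sum, Finset.mul_sum, ← Finset.sum_add_distrib,
        ← Finset.sum_add_distrib]
      exact Finset.sum_congr rfl fun i _ => by rw [smul_eq_mul]; ring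
    have e2 : ∑ i, proportion C n ω i * v i ^ 2 ≤ B ^ 2 := by
      calc _ ≤ ∑ i, proportion C n ω i * B ^ 2 := Finset.sum_le_sum fun i _ =>
            mul_le_mul_of_nonneg_left (sq_le_sq' (by have := abs_le.1 (hB i); linarith)
              (abs_le.1 (hB i)).2) (hm.1 i)
        _ = B ^ 2 := by rw [← Finset.sum_mul, hm.2, one_mul]
    rw [e1, hm.2, hz]
    have e3 := mul_le_mul_of_nonneg_left e2 (sq_nonneg lam)
    have e4 : (1 + lam / ((n : ℝ) + 1)) ^ 2 * y ^ 2
        = y ^ 2 * 1 + 2 * lam * y * (y / ((n : ℝ) + 1)) + (lam / ((n : ℝ) + 1) * y) ^ 2 := by ring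
    have e5 := sq_nonneg (lam / ((n : ℝ) + 1) * y)
    linarith
  have hi1 : Integrable (fun ω => (1 + lam / ((n : ℝ) + 1)) ^ 2 * (C n ω ⬝ᵥ v) ^ 2
      + lam ^ 2 * B ^ 2) μ :=
    ((h.integrable_dotProduct_sq hR hc n v).const_mul _).add (integrable_const _)
  refine (integral_mono_of_nonneg (ae_of_all _ fun ω => ?_) hi1 (ae_of_all _ hle)).trans ?_
  · exact Finset.sum_nonneg fun i _ => mul_nonneg ((h.proportion_mem hR hc n ω).1 i) (sq_nonneg _)
  · rw [integral_add ((h.integrable_dotProduct_sq hR hc n v).const_mul _) (integrable_const _),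
      integral_const_mul]
    simp

theorem integral_dotProduct_sq_le (h : IsUrnProcess μ R c₀ C X) (hR : R ∈ rowStochastic ℝ K)
    (hc : c₀ ∈ stdSimplex ℝ K) (hv : R *ᵥ v = lam • v) (hB : ∀ i, |v i| ≤ B) (n : ℕ) :
    ∫ ω, (C n ω ⬝ᵥ v) ^ 2 ∂μ
      ≤ (c₀ ⬝ᵥ v) ^ 2 * PiProd n lam ^ 2 + lam ^ 2 * B ^ 2 * varianceRec lam (fun _ => 1) n := by
  induction n with
  | zero => simp [h.init, PiProd_zero, varianceRec]
  | succ n ih =>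
    refine (h.integral_dotProduct_sq_succ_le hR hc hv hB n).trans ?_
    have := mul_le_mul_of_nonneg_left ih (sq_nonneg (1 + lam / ((n : ℝ) + 1)))
    rw [PiProd_succ, varianceRec_succ]
    refine (add_le_add_left this _).trans (le_of_eq ?_)
    ring

/-- The conditional mean λ Y_n/(n+1) of the increment merges with Y_n in the exponent, which
rescales θ by 1 + λ/(n+1); the centred part contributes the Gaussian factor. -/
theorem norm_charDot_succ_sub_le (h : IsUrnProcess μ R c₀ C X) (hR : R ∈ rowStochastic ℝ K)
    (hc : c₀ ∈ stdSimplex ℝ K) (hv : R *ᵥ v = lam • v) (hB : ∀ i, |v i| ≤ B) {σ2 : ℝ}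
    (hσ : 0 ≤ σ2) (n : ℕ) (θ : ℝ) :
    ‖charDot μ C v (n + 1) θ - charDot μ C v n (θ * (1 + lam / ((n : ℝ) + 1)))
        * (Real.exp (-(θ ^ 2 * (lam ^ 2 * σ2 / 2))) : ℝ)‖
      ≤ θ ^ 2 * (lam ^ 2 / 2 * ∫ ω, |drawVariance C v n ω - σ2| ∂μ)
        + |θ| ^ 3 * (|lam| ^ 3 * (32 * B ^ 3 + √(σ2 / 2) ^ 3)) := by
  have e : ∀ ω, C (n + 1) ω ⬝ᵥ v = C n ω ⬝ᵥ v + lam * v (X n ω) := fun ω => by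
    rw [h.dotProduct_succ, hv]; rfl
  have hcont : ∀ a : ℝ, Continuous fun y : ℝ => Complex.exp ((θ * (y + a) : ℝ) * Complex.I) :=
    fun a => by fun_prop
  have hd := h.integral_draw hR hc n
    (fun i ω => Complex.exp ((θ * (C n ω ⬝ᵥ v + lam * v i) : ℝ) * Complex.I))
    (fun i => (hcont _).comp_stronglyMeasurable (h.stronglyMeasurable_dotProduct n v))
    (fun i => ⟨1, fun ω => (Complex.norm_exp_ofReal_mul_I _).le⟩)
  set F : Ω → ℂ := fun ω => Complex.exp ((θ * (C n ω ⬝ᵥ v) : ℝ) * Complex.I) with hF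
  set S : Ω → ℂ := fun ω =>
    ∑ i, (proportion C n ω i : ℂ) * Complex.exp (((θ * lam) * v i : ℝ) * Complex.I) with hS
  set T : Ω → ℂ := fun ω =>
    Complex.exp (((θ * lam) * (proportion C n ω ⬝ᵥ v) : ℝ) * Complex.I) with hTdef
  set g : ℂ := ((Real.exp (-((θ * lam) ^ 2 * (σ2 / 2))) : ℝ) : ℂ) with hg
  have h1 : charDot μ C v (n + 1) θ = ∫ ω, F ω * S ω ∂μ := by
    rw [charDot]
    simp only [e]
    rw [hd]
    refine integral_congr_ae (ae_of_all _ fun ω => ?_)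
    simp only [hF, hS, Finset.mul_sum]
    refine Finset.sum_congr rfl fun i _ => ?_
    rw [Complex.real_smul, mul_left_comm, ← Complex.exp_add]
    congr 2
    push_cast
    ring
  have h2 : charDot μ C v n (θ * (1 + lam / ((n : ℝ) + 1)))
        * (Real.exp (-(θ ^ 2 * (lam ^ 2 * σ2 / 2))) : ℝ) = ∫ ω, F ω * (T ω * g) ∂μ := by
    rw [charDot, ← integral_mul_const]
    refine integral_congr_ae (ae_of_all _ fun ω => ?_)
    simp only [hF, hTdef, hg, proportion_dotProduct]
    rw [← mul_assoc, ← Complex.exp_add]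
    congr 2
    · push_cast
      ring
    · ring_nf
  have mF : Measurable F := (by fun_prop : Continuous fun y : ℝ =>
    Complex.exp ((θ * y : ℝ) * Complex.I)).measurable.comp (h.measurable_dotProduct n v)
  have mT : Measurable T := by
    simp only [hTdef, proportion_dotProduct]
    exact (by fun_prop : Continuous fun y : ℝ =>
      Complex.exp (((θ * lam) * (y / ((n : ℝ) + 1)) : ℝ) * Complex.I)).measurable.comp
        (h.measurable_dotProduct n v)
  have mS : Measurable S := Finset.measurable_sum _ fun i _ =>
    (Complex.measurable_ofReal.comp (h.measurable_proportion n i)).mul_const _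
  have nF : ∀ ω, ‖F ω‖ = 1 := fun ω => Complex.norm_exp_ofReal_mul_I _
  have nT : ∀ ω, ‖T ω‖ = 1 := fun ω => Complex.norm_exp_ofReal_mul_I _
  have nS : ∀ ω, ‖S ω‖ ≤ 1 := fun ω => by
    have hm := h.proportion_mem hR hc n ω
    rw [← hm.2]
    refine (norm_sum_le _ _).trans (Finset.sum_le_sum fun i _ => ?_)
    rw [norm_mul, Complex.norm_exp_ofReal_mul_I, mul_one, Complex.norm_real, Real.norm_eq_abs,
      abs_of_nonneg (hm.1 i)]
  have i1 : Integrable (fun ω => F ω * S ω) μ :=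
    Integrable.of_bound (mF.mul mS).aestronglyMeasurable 1 (ae_of_all _ fun ω => by
      rw [norm_mul, nF, one_mul]; exact nS ω)
  have i2 : Integrable (fun ω => F ω * (T ω * g)) μ :=
    Integrable.of_bound (mF.mul (mT.mul_const g)).aestronglyMeasurable ‖g‖ (ae_of_all _ fun ω => by
      rw [norm_mul, norm_mul, nF, nT, one_mul, one_mul])
  rw [h1, h2, ← integral_sub i1 i2]
  have i3 : Integrable (fun ω => |drawVariance C v n ω - σ2|) μ :=
    ((h.integrable_drawVariance hR hc n v).sub (integrable_const σ2)).abs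
  refine (norm_integral_le_of_norm_le (g := fun ω =>
    (θ * lam) ^ 2 / 2 * |drawVariance C v n ω - σ2|
      + |θ * lam| ^ 3 * (32 * B ^ 3 + √(σ2 / 2) ^ 3))
    ((i3.const_mul _).add (integrable_const _)) (ae_of_all _ fun ω => ?_)).trans (le_of_eq ?_)
  · rw [← mul_sub, norm_mul, nF, one_mul]
    exact norm_sum_mul_cexp_sub_le (h.proportion_mem hR hc n ω) hB hσ (θ * lam)
  · rw [integral_add (i3.const_mul _) (integrable_const _), integral_const_mul]
    simp only [integral_const, probReal_univ, one_smul, abs_mul]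
    ring

/-- Iterating rescales θ by all later multipliers. Quadratic errors therefore follow `varianceRec`
exactly; for cubic ones, two of the three multiplier factors do so and the third is bounded by
Π_n(κ). Taking κ ≥ 0 makes this majorant increasing and at least 1. -/
theorem norm_charDot_sub_le (h : IsUrnProcess μ R c₀ C X) (hR : R ∈ rowStochastic ℝ K)
    (hc : c₀ ∈ stdSimplex ℝ K) (hv : R *ᵥ v = lam • v) (hB : ∀ i, |v i| ≤ B) {σ2 : ℝ}
    (hσ : 0 ≤ σ2) (hB0 : 0 ≤ B) (hlam : -1 ≤ lam) {κ : ℝ} (hκ0 : 0 ≤ κ) (hκ : lam ≤ κ)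
    (n : ℕ) (θ : ℝ) :
    ‖charDot μ C v n θ - Complex.exp ((θ * PiProd n lam * (c₀ ⬝ᵥ v) : ℝ) * Complex.I)
        * (Real.exp (-(θ ^ 2 * (lam ^ 2 * σ2 / 2) * varianceRec lam (fun _ => 1) n)) : ℝ)‖
      ≤ θ ^ 2 * varianceRec lam
            (fun m => lam ^ 2 / 2 * ∫ ω, |drawVariance C v m ω - σ2| ∂μ) n
        + |θ| ^ 3 * (|lam| ^ 3 * (32 * B ^ 3 + √(σ2 / 2) ^ 3))
          * (PiProd n κ * varianceRec lam (fun _ => 1) n) := by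
  induction n generalizing θ with
  | zero => simp [charDot, h.init, PiProd_zero, varianceRec]
  | succ n ih =>
    have ih := ih (θ * (1 + lam / ((n : ℝ) + 1)))
    have hs := h.norm_charDot_succ_sub_le hR hc hv hB hσ n θ
    have hρ0 := multiplier_nonneg hlam n
    have hρκ : (1 + lam / ((n : ℝ) + 1)) * PiProd n κ ≤ PiProd (n + 1) κ := by
      rw [PiProd_succ]
      have := PiProd_pos hκ0 n
      gcongr
    have hQ1 := one_le_PiProd hκ0 (n + 1)
    have hA := varianceRec_one_nonneg lam n
    have hK0 : 0 ≤ |lam| ^ 3 * (32 * B ^ 3 + √(σ2 / 2) ^ 3) := by positivity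
    rw [varianceRec_succ, varianceRec_succ, PiProd_succ n lam]
    set ρ := 1 + lam / ((n : ℝ) + 1)
    set A := varianceRec lam (fun _ => 1) n
    set E := varianceRec lam (fun m => lam ^ 2 / 2 * ∫ ω, |drawVariance C v m ω - σ2| ∂μ) n
    set K' := |lam| ^ 3 * (32 * B ^ 3 + √(σ2 / 2) ^ 3)
    set g : ℂ := ((Real.exp (-(θ ^ 2 * (lam ^ 2 * σ2 / 2))) : ℝ) : ℂ) with hg
    have hg1 : ‖g‖ ≤ 1 := by
      rw [hg, Complex.norm_real, Real.norm_eq_abs, abs_of_pos (Real.exp_pos _)]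
      refine Real.exp_le_one_iff.2 ?_
      have : 0 ≤ θ ^ 2 * (lam ^ 2 * σ2 / 2) := by positivity
      linarith
    have e : Complex.exp ((θ * (ρ * PiProd n lam) * (c₀ ⬝ᵥ v) : ℝ) * Complex.I)
        * (Real.exp (-(θ ^ 2 * (lam ^ 2 * σ2 / 2) * (ρ ^ 2 * A + 1))) : ℝ)
        = (Complex.exp ((θ * ρ * PiProd n lam * (c₀ ⬝ᵥ v) : ℝ) * Complex.I)
        * (Real.exp (-((θ * ρ) ^ 2 * (lam ^ 2 * σ2 / 2) * A)) : ℝ)) * g := by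
      rw [hg, mul_assoc (Complex.exp _), ← Complex.ofReal_mul, ← Real.exp_add]
      congr 2
      · push_cast; ring
      · congr 1; ring
    rw [e]
    have tri : ‖charDot μ C v (n + 1) θ
        - (Complex.exp ((θ * ρ * PiProd n lam * (c₀ ⬝ᵥ v) : ℝ) * Complex.I)
        * (Real.exp (-((θ * ρ) ^ 2 * (lam ^ 2 * σ2 / 2) * A)) : ℝ)) * g‖
        ≤ ‖charDot μ C v (n + 1) θ - charDot μ C v n (θ * ρ) * g‖
          + ‖(charDot μ C v n (θ * ρ)
            - (Complex.exp ((θ * ρ * PiProd n lam * (c₀ ⬝ᵥ v) : ℝ) * Complex.I)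
        * (Real.exp (-((θ * ρ) ^ 2 * (lam ^ 2 * σ2 / 2) * A)) : ℝ))) * g‖ := by
      rw [sub_mul]
      exact norm_sub_le_norm_sub_add_norm_sub _ _ _
    refine tri.trans ((add_le_add hs
      (d := (θ * ρ) ^ 2 * E + |θ * ρ| ^ 3 * K' * (PiProd n κ * A)) ?_).trans ?_)
    · rw [norm_mul]
      exact (mul_le_of_le_one_right (norm_nonneg _) hg1).trans ih
    · rw [abs_mul, abs_of_nonneg hρ0]
      -- The fresh error 1 is absorbed because Π_{n+1}(κ) ≥ 1.
      have b1 : ρ ^ 2 * A * (ρ * PiProd n κ) + 1 ≤ PiProd (n + 1) κ * (ρ ^ 2 * A + 1) := by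
        have : ρ ^ 2 * A * (ρ * PiProd n κ) ≤ ρ ^ 2 * A * PiProd (n + 1) κ := by gcongr
        linarith
      have b2 := mul_le_mul_of_nonneg_left b1 (show 0 ≤ |θ| ^ 3 * K' by positivity)
      linarith

end IsUrnProcess

end

/-! ### Central limit theorem for an eigenvector functional -/

section

/-- Π_n(κ)² is the supersolution in the comparison. Source 1 yields the limiting variance; a source
tending to 0 yields the vanishing of accumulated errors. -/
theorem tendsto_varianceRec_div {lam κ η δ : ℝ} {w d : ℕ → ℝ} (hlam : -1 ≤ lam) (hκ0 : 0 ≤ κ)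
    (hκ : lam ≤ κ) (hw : ∀ᶠ n in atTop, 0 < w n)
    (he : Tendsto (fun n => w (n + 1) - (1 + lam / ((n : ℝ) + 1)) ^ 2 * w n) atTop (𝓝 η))
    (hη : 0 < η) (hq : Tendsto (fun n => PiProd n κ / √(w n)) atTop (𝓝 0))
    (hd : Tendsto d atTop (𝓝 δ)) :
    Tendsto (fun n => varianceRec lam d n / w n) atTop (𝓝 (δ / η)) := by
  refine tendsto_div_of_linear_recursion (ρ := fun n => (1 + lam / ((n : ℝ) + 1)) ^ 2)
    (q := fun n => PiProd n κ ^ 2) (fun n => sq_nonneg _) (fun n => rfl) (fun n => by ring)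
    hw hd he hη (fun n => pow_pos (PiProd_pos hκ0 n) 2) (fun n => ?_) ?_
  · rw [PiProd_succ, mul_pow]
    have := multiplier_nonneg hlam n
    have := PiProd_pos hκ0 n
    gcongr
  · have h2 := hq.pow 2
    rw [zero_pow two_ne_zero] at h2
    refine h2.congr' ?_
    filter_upwards [hw] with n hn
    rw [div_pow, Real.sq_sqrt hn.le]

theorem sq_integral_abs_le {Ω : Type*} [MeasurableSpace Ω] {μ : Measure Ω} [IsProbabilityMeasure μ]
    {f : Ω → ℝ} (hf : Integrable f μ) (hf2 : Integrable (fun ω => f ω ^ 2) μ) :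
    (∫ ω, |f ω| ∂μ) ^ 2 ≤ ∫ ω, f ω ^ 2 ∂μ := by
  set m := ∫ ω, |f ω| ∂μ with hm
  have h0 : 0 ≤ ∫ ω, (f ω ^ 2 - 2 * m * |f ω| + m ^ 2) ∂μ := integral_nonneg fun ω => by
    have : f ω ^ 2 - 2 * m * |f ω| + m ^ 2 = (|f ω| - m) ^ 2 := by rw [sub_sq, sq_abs]; ring
    simp only [this]
    positivity
  have h1 : Integrable (fun ω => f ω ^ 2 - 2 * m * |f ω|) μ := hf2.sub (hf.abs.const_mul _)
  rw [integral_add h1 (integrable_const _), integral_sub hf2 (hf.abs.const_mul _),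
    integral_const_mul, ← hm] at h0
  simp only [integral_const, probReal_univ, one_smul] at h0
  linarith

variable {K : Type*} [Fintype K] [MeasurableSpace K] {Ω : Type*} [MeasurableSpace Ω] {μ : Measure Ω}
  {R : Matrix K K ℝ} {c₀ : K → ℝ} {C : ℕ → Ω → K → ℝ} {X : ℕ → Ω → K} {v : K → ℝ} {lam : ℝ}
  [DecidableEq K] [IsProbabilityMeasure μ] [MeasurableSingletonClass K]

namespace IsUrnProcess

/-- The central limit theorem for `C n ⬝ᵥ v`, where `v` is an eigenvector of the replacement
matrix: the normalization `w` solves asymptotically the recursion of the variances. -/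
theorem convergesWeaklyToNormal (h : IsUrnProcess μ R c₀ C X) (hR : R ∈ rowStochastic ℝ K)
    (hc : c₀ ∈ stdSimplex ℝ K) (hv : R *ᵥ v = lam • v) (hlam : -1 ≤ lam)
    {κ η σ2 : ℝ} {w : ℕ → ℝ} (hκ0 : 0 ≤ κ) (hκ : lam ≤ κ) (hw : ∀ᶠ n in atTop, 0 < w n)
    (he : Tendsto (fun n => w (n + 1) - (1 + lam / ((n : ℝ) + 1)) ^ 2 * w n) atTop (𝓝 η))
    (hη : 0 < η) (hq : Tendsto (fun n => PiProd n κ / √(w n)) atTop (𝓝 0)) (hσ : 0 ≤ σ2)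
    (hvar : Tendsto (fun n => ∫ ω, |drawVariance C v n ω - σ2| ∂μ) atTop (𝓝 0)) :
    ConvergesWeaklyToNormal μ (fun n ω => (C n ω ⬝ᵥ v) / √(w n))
      (lam ^ 2 / η * σ2).toNNReal := by
  obtain ⟨B₀, hB₀⟩ := exists_abs_le v
  have hB : ∀ i, |v i| ≤ |B₀| := fun i => (hB₀ i).trans (le_abs_self _)
  have hB0 : 0 ≤ |B₀| := abs_nonneg _
  generalize |B₀| = B at hB hB0
  refine ⟨fun n => ((h.measurable_dotProduct n v).div_const _).aemeasurable, aemeasurable_id, ?_⟩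
  refine ProbabilityMeasure.tendsto_iff_tendsto_charFun.2 fun t => ?_
  simp only [ProbabilityMeasure.coe_mk, Measure.map_id, charFun_gaussianReal]
  have hv0 : 0 ≤ lam ^ 2 / η * σ2 := by positivity
  rw [Real.coe_toNNReal _ hv0]
  have hA := tendsto_varianceRec_div hlam hκ0 hκ hw he hη hq
    (tendsto_const_nhds (x := (1 : ℝ)))
  have hE := tendsto_varianceRec_div hlam hκ0 hκ hw he hη hq (hvar.const_mul (lam ^ 2 / 2))
  rw [mul_zero, zero_div] at hE
  have hphi : ∀ n, charFun (μ.map fun ω => (C n ω ⬝ᵥ v) / √(w n)) t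
      = charDot μ C v n (t / √(w n)) := fun n => by
    rw [charFun_apply_real, integral_map ((h.measurable_dotProduct n v).div_const _).aemeasurable
      (by fun_prop), charDot]
    refine integral_congr_ae (ae_of_all _ fun ω => ?_)
    simp only
    congr 2
    push_cast
    ring
  simp only [hphi]
  set G : ℕ → ℂ := fun n =>
    Complex.exp ((t / √(w n) * PiProd n lam * (c₀ ⬝ᵥ v) : ℝ) * Complex.I)
      * (Real.exp (-((t / √(w n)) ^ 2 * (lam ^ 2 * σ2 / 2) * varianceRec lam (fun _ => 1) n)) : ℝ)
    with hG
  -- The initial composition enters only through the phase Π_n(λ) c₀v, so it is forgotten in the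
  -- limit.
  have hPi : Tendsto (fun n => PiProd n lam / √(w n)) atTop (𝓝 0) := by
    refine squeeze_zero_norm (fun n => ?_) hq
    rw [Real.norm_eq_abs, abs_div, abs_of_nonneg (Real.sqrt_nonneg _)]
    exact div_le_div_of_nonneg_right (abs_PiProd_le hlam hκ n) (Real.sqrt_nonneg _)
  have hGlim : Tendsto G atTop (𝓝 (Complex.exp (t * (0 : ℝ) * Complex.I
      - ((lam ^ 2 / η * σ2 : ℝ) : ℂ) * t ^ 2 / 2))) := by
    have l1 : Tendsto (fun n =>
        Complex.exp ((t / √(w n) * PiProd n lam * (c₀ ⬝ᵥ v) : ℝ) * Complex.I)) atTop (𝓝 1) := by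
      have : Tendsto (fun n => t / √(w n) * PiProd n lam * (c₀ ⬝ᵥ v)) atTop (𝓝 0) := by
        have := hPi.const_mul (t * (c₀ ⬝ᵥ v))
        rw [mul_zero] at this
        exact this.congr fun n => by ring
      have hcont : Continuous fun y : ℝ => Complex.exp ((y : ℂ) * Complex.I) := by fun_prop
      have := (hcont.tendsto 0).comp this
      rw [Complex.ofReal_zero, zero_mul, Complex.exp_zero] at this
      exact this
    have l2 : Tendsto (fun n =>
        -((t / √(w n)) ^ 2 * (lam ^ 2 * σ2 / 2) * varianceRec lam (fun _ => 1) n)) atTop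
        (𝓝 (-(t ^ 2 * (lam ^ 2 * σ2 / 2) * (1 / η)))) := by
      refine ((hA.const_mul _).neg).congr' ?_
      filter_upwards [hw] with n hn
      rw [div_pow, Real.sq_sqrt hn.le]
      ring
    have l3 := l1.mul ((Complex.continuous_ofReal.tendsto _).comp
      ((Real.continuous_exp.tendsto _).comp l2))
    have e : Complex.exp (t * (0 : ℝ) * Complex.I - ((lam ^ 2 / η * σ2 : ℝ) : ℂ) * t ^ 2 / 2)
        = 1 * ((Real.exp (-(t ^ 2 * (lam ^ 2 * σ2 / 2) * (1 / η))) : ℝ) : ℂ) := by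
      rw [one_mul, Complex.ofReal_exp]
      congr 1
      push_cast
      ring
    rw [e]
    exact l3
  -- At θ = t/√w the quadratic error is a variance recursion with vanishing source divided by w, and
  -- the cubic one gains the factor Π_n(κ)/√w.
  have hdiff : Tendsto (fun n => charDot μ C v n (t / √(w n)) - G n) atTop (𝓝 0) := by
    refine squeeze_zero_norm' (a := fun n => t ^ 2 * (varianceRec lam
            (fun m => lam ^ 2 / 2 * ∫ ω, |drawVariance C v m ω - σ2| ∂μ) n / w n)
        + |t| ^ 3 * (|lam| ^ 3 * (32 * B ^ 3 + √(σ2 / 2) ^ 3))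
          * (PiProd n κ / √(w n) * (varianceRec lam (fun _ => 1) n / w n))) ?_ ?_
    · filter_upwards [hw] with n hn
      refine (h.norm_charDot_sub_le hR hc hv hB hσ hB0 hlam hκ0 hκ n (t / √(w n))).trans
        (le_of_eq ?_)
      have hs : 0 < √(w n) := Real.sqrt_pos.2 hn
      have hs2 : √(w n) ^ 2 = w n := Real.sq_sqrt hn.le
      rw [abs_div, abs_of_pos hs]
      generalize varianceRec lam
        (fun m => lam ^ 2 / 2 * ∫ ω, |drawVariance C v m ω - σ2| ∂μ) n = E
      generalize √(w n) = r at hs hs2 ⊢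
      rw [← hs2]
      field_simp
    · have := (hE.const_mul (t ^ 2)).add ((hq.mul hA).const_mul
        (|t| ^ 3 * (|lam| ^ 3 * (32 * B ^ 3 + √(σ2 / 2) ^ 3))))
      rwa [zero_mul, mul_zero, mul_zero, add_zero] at this
  have := hdiff.add hGlim
  rw [zero_add] at this
  exact this.congr fun n => by ring

/-- The second moment of C n ⬝ᵥ v is O(w n), and w n = o(n²). -/
theorem tendsto_integral_proportion_sq (h : IsUrnProcess μ R c₀ C X) (hR : R ∈ rowStochastic ℝ K)
    (hc : c₀ ∈ stdSimplex ℝ K) (hv : R *ᵥ v = lam • v) (hlam : -1 ≤ lam)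
    {κ η : ℝ} {w : ℕ → ℝ} (hκ0 : 0 ≤ κ) (hκ : lam ≤ κ) (hw : ∀ᶠ n in atTop, 0 < w n)
    (he : Tendsto (fun n => w (n + 1) - (1 + lam / ((n : ℝ) + 1)) ^ 2 * w n) atTop (𝓝 η))
    (hη : 0 < η) (hq : Tendsto (fun n => PiProd n κ / √(w n)) atTop (𝓝 0))
    (hw2 : Tendsto (fun n : ℕ => w n / ((n : ℝ) + 1) ^ 2) atTop (𝓝 0)) :
    Tendsto (fun n => ∫ ω, (proportion C n ω ⬝ᵥ v) ^ 2 ∂μ) atTop (𝓝 0) := by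
  obtain ⟨B, hB⟩ := exists_abs_le v
  have hA := tendsto_varianceRec_div hlam hκ0 hκ hw he hη hq
    (tendsto_const_nhds (x := (1 : ℝ)))
  have hlim := ((((hq.pow 2).const_mul ((c₀ ⬝ᵥ v) ^ 2)).add
    (hA.const_mul (lam ^ 2 * B ^ 2))).mul hw2)
  rw [mul_zero] at hlim
  refine squeeze_zero' (Eventually.of_forall fun n => integral_nonneg fun ω => sq_nonneg _) ?_ hlim
  filter_upwards [hw] with n hn
  simp only [proportion_dotProduct, div_pow]
  rw [integral_div, Real.sq_sqrt hn.le]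
  have h1 := h.integral_dotProduct_sq_le hR hc hv hB n
  have h2 : PiProd n lam ^ 2 ≤ PiProd n κ ^ 2 := by
    rw [← sq_abs]
    exact pow_le_pow_left₀ (abs_nonneg _) (abs_PiProd_le hlam hκ n) 2
  have h3 := mul_le_mul_of_nonneg_left h2 (sq_nonneg (c₀ ⬝ᵥ v))
  have h4 : ((c₀ ⬝ᵥ v) ^ 2 * (PiProd n κ ^ 2 / w n)
      + lam ^ 2 * B ^ 2 * (varianceRec lam (fun _ => 1) n / w n)) * (w n / ((n : ℝ) + 1) ^ 2)
      = ((c₀ ⬝ᵥ v) ^ 2 * PiProd n κ ^ 2 + lam ^ 2 * B ^ 2 * varianceRec lam (fun _ => 1) n)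
        / ((n : ℝ) + 1) ^ 2 := by
    field_simp
  rw [h4]
  exact div_le_div_of_nonneg_right (by linarith) (by positivity)

end IsUrnProcess

end

/-! ### Supercritical case: L² martingale and its limit -/

section

/-- Hölder bounds the L¹ norm on a set s by B μ(s)^(1/2); B + 1 in the choice of δ avoids dividing
by zero. -/
theorem uniformIntegrable_one_of_eLpNorm_two_le {ι Ω : Type*} [MeasurableSpace Ω] {μ : Measure Ω}
    {f : ι → Ω → ℝ} {B : ℝ≥0} (hf : ∀ i, AEStronglyMeasurable (f i) μ) [IsProbabilityMeasure μ]
    (hB : ∀ i, eLpNorm (f i) 2 μ ≤ B) : UniformIntegrable f 1 μ := by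
  refine ⟨hf, fun ε hε => ?_, B, fun i =>
    (eLpNorm_le_eLpNorm_of_exponent_le (by norm_num) (hf i)).trans (hB i)⟩
  have hB1 : (0 : ℝ) < (B : ℝ) + 1 := by positivity
  refine ⟨(ε / (B + 1)) ^ 2, by positivity, fun i s hs hμs => ?_⟩
  rw [eLpNorm_indicator_eq_eLpNorm_restrict hs]
  refine (eLpNorm_le_eLpNorm_mul_rpow_measure_univ (q := 2) (by norm_num)
    (hf i).restrict).trans ?_
  rw [Measure.restrict_apply_univ]
  have e : (1 / (1 : ℝ≥0∞).toReal - 1 / (2 : ℝ≥0∞).toReal) = 1 / 2 := by norm_num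
  rw [e]
  calc eLpNorm (f i) 2 (μ.restrict s) * μ s ^ (1 / 2 : ℝ)
      ≤ ENNReal.ofReal B * ENNReal.ofReal ((ε / (B + 1)) ^ 2) ^ (1 / 2 : ℝ) := by
        rw [ENNReal.ofReal_coe_nnreal]
        gcongr
        exact (eLpNorm_mono_measure _ Measure.restrict_le_self).trans (hB i)
    _ = ENNReal.ofReal (B * (ε / (B + 1))) := by
        rw [ENNReal.ofReal_rpow_of_nonneg (by positivity) (by norm_num), ← Real.sqrt_eq_rpow,
          Real.sqrt_sq (by positivity), ← ENNReal.ofReal_mul (by positivity)]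
    _ ≤ ENNReal.ofReal ε := by
        refine ENNReal.ofReal_le_ofReal ?_
        rw [mul_div_assoc', div_le_iff₀ hB1]
        nlinarith

theorem summable_one_div_PiProd_sq {lam : ℝ} (hlam : 1 / 2 < lam) :
    Summable fun n : ℕ => 1 / PiProd n lam ^ 2 := by
  have h0 : 0 < lam := by linarith
  refine summable_of_isBigO_nat (g := fun n : ℕ => 1 / (n : ℝ) ^ (2 * lam))
    (Real.summable_one_div_nat_rpow.2 (by linarith)) ?_
  refine Asymptotics.isBigO_of_div_tendsto_nhds (c := Real.Gamma (lam + 1) ^ 2) ?_ ?_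
  · filter_upwards [eventually_gt_atTop 0] with n hn hzero
    have hn' : (0 : ℝ) < n := by exact_mod_cast hn
    exact absurd hzero (one_div_pos.2 (Real.rpow_pos_of_pos hn' _)).ne'
  · refine ((tendsto_rpow_div_PiProd h0).pow 2).congr' ?_
    filter_upwards with n
    have e : (n : ℝ) ^ (2 * lam) = ((n : ℝ) ^ lam) ^ 2 := by
      rw [mul_comm, Real.rpow_mul (Nat.cast_nonneg n), ← Real.rpow_natCast]; norm_num
    simp only [Pi.div_apply, e]
    rw [div_div_eq_mul_div, div_one, div_pow, div_mul_eq_mul_div, one_mul]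

/-- Variation of constants: Π_n(λ)² solves the homogeneous recursion. -/
theorem varianceRec_one_div_PiProd_sq {lam : ℝ} (hlam : 0 ≤ lam) (n : ℕ) :
    varianceRec lam (fun _ => 1) n / PiProd n lam ^ 2
      = ∑ k ∈ Finset.range n, 1 / PiProd (k + 1) lam ^ 2 := by
  induction n with
  | zero => simp [varianceRec]
  | succ n ih =>
    have h1 : (0 : ℝ) < 1 + lam / ((n : ℝ) + 1) := by positivity
    have h2 := PiProd_pos hlam n
    rw [Finset.sum_range_succ, ← ih, varianceRec_succ, PiProd_succ]
    generalize 1 + lam / ((n : ℝ) + 1) = ρ at h1 ⊢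
    field_simp

variable {K : Type*} [Fintype K] [MeasurableSpace K] {Ω : Type*} [MeasurableSpace Ω] {μ : Measure Ω}
  {R : Matrix K K ℝ} {c₀ : K → ℝ} {C : ℕ → Ω → K → ℝ} {X : ℕ → Ω → K} {v : K → ℝ} {lam : ℝ}
  [DecidableEq K] [IsProbabilityMeasure μ]

namespace IsUrnProcess

theorem eLpNorm_two_le_of_integral_sq_le (h : IsUrnProcess μ R c₀ C X)
    (hR : R ∈ rowStochastic ℝ K) (hc : c₀ ∈ stdSimplex ℝ K) (n : ℕ) {b c : ℝ} (hb : 0 < b)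
    (hint : ∫ ω, (C n ω ⬝ᵥ v) ^ 2 ∂μ ≤ c * b ^ 2) :
    eLpNorm (fun ω => (C n ω ⬝ᵥ v) / b) 2 μ ≤ (√c).toNNReal := by
  obtain ⟨B, hB⟩ := exists_abs_le v
  have hm : MemLp (fun ω => (C n ω ⬝ᵥ v) / b) 2 μ :=
    MemLp.of_bound ((h.measurable_dotProduct n v).div_const _).aestronglyMeasurable
      (B * ((n : ℝ) + 1) / b) (ae_of_all _ fun ω => by
        rw [Real.norm_eq_abs, abs_div, abs_of_pos hb]
        exact div_le_div_of_nonneg_right (h.abs_dotProduct_le hR hc hB n ω) hb.le)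
  rw [hm.eLpNorm_eq_integral_rpow_norm (by norm_num) (by norm_num)]
  refine ENNReal.ofReal_le_ofReal ?_
  have e : ((2 : ℝ≥0∞).toReal)⁻¹ = 1 / 2 := by norm_num
  rw [e, ← Real.sqrt_eq_rpow]
  refine Real.sqrt_le_sqrt ?_
  have e2 : ∀ ω, ‖(C n ω ⬝ᵥ v) / b‖ ^ (2 : ℝ≥0∞).toReal = (C n ω ⬝ᵥ v) ^ 2 / b ^ 2 := fun ω => by
    rw [ENNReal.toReal_ofNat, Real.rpow_two, Real.norm_eq_abs, sq_abs, div_pow]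
  simp only [e2]
  rw [integral_div, div_le_iff₀ (by positivity)]
  exact hint

variable [MeasurableSingletonClass K]

theorem exists_eLpNorm_two_le (h : IsUrnProcess μ R c₀ C X) (hR : R ∈ rowStochastic ℝ K)
    (hc : c₀ ∈ stdSimplex ℝ K) (hv : R *ᵥ v = lam • v) (hlam : 1 / 2 < lam) :
    ∃ B : ℝ≥0, ∀ n : ℕ, eLpNorm (fun ω => (C n ω ⬝ᵥ v) / PiProd n lam) 2 μ ≤ B := by
  have h0 : 0 ≤ lam := by linarith
  obtain ⟨B, hB⟩ := exists_abs_le v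
  have hs := (summable_nat_add_iff 1).2 (summable_one_div_PiProd_sq hlam)
  refine ⟨_, fun n => h.eLpNorm_two_le_of_integral_sq_le hR hc n (PiProd_pos h0 n)
    (c := (c₀ ⬝ᵥ v) ^ 2 + lam ^ 2 * B ^ 2 * ∑' k : ℕ, 1 / PiProd (k + 1) lam ^ 2) ?_⟩
  refine (h.integral_dotProduct_sq_le hR hc hv hB n).trans ?_
  have hP := PiProd_pos h0 n
  have h1 : varianceRec lam (fun _ => 1) n
      ≤ (∑' k : ℕ, 1 / PiProd (k + 1) lam ^ 2) * PiProd n lam ^ 2 := by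
    rw [← div_le_iff₀ (by positivity), varianceRec_one_div_PiProd_sq h0]
    exact hs.sum_le_tsum _ fun k _ => by positivity
  have := mul_le_mul_of_nonneg_left h1 (show 0 ≤ lam ^ 2 * B ^ 2 by positivity)
  linarith

theorem martingale_dotProduct_div_PiProd (h : IsUrnProcess μ R c₀ C X) (hR : R ∈ rowStochastic ℝ K)
    (hc : c₀ ∈ stdSimplex ℝ K) (hv : R *ᵥ v = lam • v) (hlam : 0 ≤ lam) :
    Martingale (fun n ω => (C n ω ⬝ᵥ v) / PiProd n lam) h.filtration μ := by
  have hsm : ∀ n, StronglyMeasurable[h.filtration n] fun ω => (C n ω ⬝ᵥ v) / PiProd n lam :=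
    fun n => by
      simp only [div_eq_mul_inv]
      exact (h.stronglyMeasurable_dotProduct n v).mul stronglyMeasurable_const
  refine martingale_of_setIntegral_eq_succ hsm
    (fun n => (h.integrable_dotProduct hR hc n v).div_const _) fun n s hs => ?_
  have hs' := h.filtration.le n s hs
  obtain ⟨B, hB⟩ := exists_abs_le v
  -- Putting the indicator of the past event s inside G turns the averaging identity into the
  -- set-integral form of the martingale property.
  have hd := h.integral_draw hR hc n
    (fun i => s.indicator fun ω => (C n ω ⬝ᵥ v + lam * v i) * (PiProd (n + 1) lam)⁻¹)
    (fun i => (((h.stronglyMeasurable_dotProduct n v).add stronglyMeasurable_const).mul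
      stronglyMeasurable_const).indicator hs)
    (fun i => ⟨(B * ((n : ℝ) + 1) + |lam * v i|) * |(PiProd (n + 1) lam)⁻¹|, fun ω => by
      refine (norm_indicator_le_norm_self _ _).trans ?_
      rw [Real.norm_eq_abs, abs_mul]
      exact mul_le_mul_of_nonneg_right ((abs_add_le _ _).trans
        (add_le_add (h.abs_dotProduct_le hR hc hB n ω) le_rfl)) (abs_nonneg _)⟩)
  rw [← integral_indicator hs', ← integral_indicator hs']
  refine Eq.trans ?_ (hd.symm.trans ?_)
  · refine integral_congr_ae (ae_of_all _ fun ω => ?_)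
    by_cases hω : ω ∈ s
    · simp only [Set.indicator_of_mem hω, smul_eq_mul]
      have hm := h.proportion_mem hR hc n ω
      have hz := proportion_dotProduct (C := C) n ω v
      have e : ∑ i, proportion C n ω i * ((C n ω ⬝ᵥ v + lam * v i) * (PiProd (n + 1) lam)⁻¹)
          = ((C n ω ⬝ᵥ v) * ∑ i, proportion C n ω i + lam * (proportion C n ω ⬝ᵥ v))
            * (PiProd (n + 1) lam)⁻¹ := by
        generalize C n ω ⬝ᵥ v = y
        rw [dotProduct, Finset.mul_sum, Finset.mul_sum, ← Finset.sum_add_distrib, Finset.sum_mul]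
        exact Finset.sum_congr rfl fun i _ => by ring
      rw [e, hm.2, hz, PiProd_succ]
      have h1 : (0 : ℝ) < 1 + lam / ((n : ℝ) + 1) := by positivity
      have h2 := PiProd_pos hlam n
      have e2 : (C n ω ⬝ᵥ v) * 1 + lam * ((C n ω ⬝ᵥ v) / ((n : ℝ) + 1))
          = (1 + lam / ((n : ℝ) + 1)) * (C n ω ⬝ᵥ v) := by ring
      rw [e2]
      generalize 1 + lam / ((n : ℝ) + 1) = ρ at h1 ⊢
      field_simp
    · simp [Set.indicator_of_notMem hω]
  · refine integral_congr_ae (ae_of_all _ fun ω => ?_)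
    by_cases hω : ω ∈ s
    · simp only [Set.indicator_of_mem hω, h.dotProduct_succ, hv, Pi.smul_apply, smul_eq_mul,
        div_eq_mul_inv]
    · simp [Set.indicator_of_notMem hω]

/-- The mean share of a colour is the probability of drawing it. -/
theorem integral_composition_eq_zero (h : IsUrnProcess μ R c₀ C X) (hR : R ∈ rowStochastic ℝ K)
    (hc : c₀ ∈ stdSimplex ℝ K) (n : ℕ) (i : K) (hX : ∀ᵐ ω ∂μ, X n ω ≠ i) :
    ∫ ω, C n ω i ∂μ = 0 := by
  have hd := h.integral_draw hR hc n (fun k _ => if k = i then (1 : ℝ) else 0)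
    (fun k => stronglyMeasurable_const) (fun k => ⟨_, fun ω => le_rfl⟩)
  simp only [smul_eq_mul, mul_ite, mul_one, mul_zero, Finset.sum_ite_eq', Finset.mem_univ,
    if_true, proportion] at hd
  rw [integral_div, integral_congr_ae (g := fun _ => (0 : ℝ))
    (hX.mono fun ω hω => if_neg hω), integral_zero] at hd
  have : ((n : ℝ) + 1) ≠ 0 := by positivity
  exact (div_eq_zero_iff.1 hd.symm).resolve_right this

theorem exists_nonDegenerate_limit (h : IsUrnProcess μ R c₀ C X) (hR : R ∈ rowStochastic ℝ K)
    (hc : c₀ ∈ stdSimplex ℝ K) (hv : R *ᵥ v = lam • v) (hlam : 1 / 2 < lam) {m : ℕ} {i j : K}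
    (hij : v i ≠ v j) (hi : ∫ ω, C m ω i ∂μ ≠ 0) (hj : ∫ ω, C m ω j ∂μ ≠ 0) :
    ∃ V : Ω → ℝ, Measurable V ∧ NonDegenerate μ V ∧
      ∀ᵐ ω ∂μ, Tendsto (fun n : ℕ => (C n ω ⬝ᵥ v) / (n : ℝ) ^ lam) atTop (𝓝 (V ω)) := by
  have h0 : 0 < lam := by linarith
  have hM := h.martingale_dotProduct_div_PiProd hR hc hv h0.le
  obtain ⟨B, hB⟩ := h.exists_eLpNorm_two_le hR hc hv hlam
  have hUI : UniformIntegrable (fun n ω => (C n ω ⬝ᵥ v) / PiProd n lam) 1 μ :=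
    uniformIntegrable_one_of_eLpNorm_two_le
      (fun n => ((h.measurable_dotProduct n v).div_const _).aestronglyMeasurable) hB
  obtain ⟨B', hB'⟩ := hUI.2.2
  have hG : (0 : ℝ) < Real.Gamma (lam + 1) := Real.Gamma_pos_of_pos (by linarith)
  have hlim := hM.submartingale.ae_tendsto_limitProcess hB'
  set L := Filtration.limitProcess (fun n ω => (C n ω ⬝ᵥ v) / PiProd n lam) h.filtration μ with hL
  refine ⟨fun ω => L ω * (Real.Gamma (lam + 1))⁻¹, ?_, ?_, ?_⟩
  · exact (Filtration.stronglyMeasurable_limit_process').measurable.mul_const _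
  · rintro ⟨a, ha⟩
    have hLa : L =ᵐ[μ] fun _ => a * Real.Gamma (lam + 1) := by
      filter_upwards [ha] with ω hω
      rw [← hω, mul_assoc, inv_mul_cancel₀ hG.ne', mul_one]
    -- By uniform integrability each term is the conditional expectation of the limit, so a constant
    -- limit forces constant terms. Subtracting two consecutive terms then fixes v(X_m), as λ ≠ 0.
    have hconst : ∀ n, ∀ᵐ ω ∂μ, C n ω ⬝ᵥ v = a * Real.Gamma (lam + 1) * PiProd n lam := fun n => by
      filter_upwards [hM.ae_eq_condExp_limitProcess hUI n,
        condExp_congr_ae (m := h.filtration n) hLa] with ω h1 h2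
      rw [h2, condExp_const (h.filtration.le n)] at h1
      rwa [div_eq_iff (PiProd_pos h0.le n).ne'] at h1
    have hdraw : ∃ b, ∀ᵐ ω ∂μ, v (X m ω) = b := by
      refine ⟨(a * Real.Gamma (lam + 1) * PiProd (m + 1) lam
        - a * Real.Gamma (lam + 1) * PiProd m lam) / lam, ?_⟩
      filter_upwards [hconst m, hconst (m + 1)] with ω h1 h2
      rw [h.dotProduct_succ, h1, hv, Pi.smul_apply, smul_eq_mul] at h2
      rw [eq_div_iff h0.ne']
      linarith
    obtain ⟨b, hb⟩ := hdraw
    have hval : ∀ k, ∫ ω, C m ω k ∂μ ≠ 0 → v k = b := fun k hk => by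
      by_contra hne
      refine hk (h.integral_composition_eq_zero hR hc m k (hb.mono fun ω hω hXk => hne ?_))
      rw [← hXk, hω]
    exact hij ((hval i hi).trans (hval j hj).symm)
  · filter_upwards [hlim] with ω hω
    refine (hω.mul (tendsto_PiProd_div_rpow h0)).congr fun n => ?_
    have := (PiProd_pos h0.le n).ne'
    field_simp

end IsUrnProcess

end

/-! ### The three-colour urn: conditional variance and positivity -/

section

theorem tendsto_PiProd_div_nat_add_one {κ : ℝ} (hκ0 : 0 < κ) (hκ : κ < 1) :
    Tendsto (fun n : ℕ => PiProd n κ / ((n : ℝ) + 1)) atTop (𝓝 0) := by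
  have h1 : Tendsto (fun n : ℕ => (n : ℝ) ^ (-(1 - κ))) atTop (𝓝 0) :=
    (tendsto_rpow_neg_atTop (by linarith)).comp tendsto_natCast_atTop_atTop
  have h2 := (tendsto_PiProd_div_rpow hκ0).mul h1
  rw [mul_zero] at h2
  refine squeeze_zero' (Eventually.of_forall fun n => by have := PiProd_pos hκ0.le n; positivity)
    ?_ h2
  filter_upwards [eventually_gt_atTop 0] with n hn
  have hn' : (0 : ℝ) < n := by exact_mod_cast hn
  have hP := PiProd_pos hκ0.le n
  rw [neg_sub, Real.rpow_sub hn', Real.rpow_one]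
  have := Real.rpow_pos_of_pos hn' κ
  have e : PiProd n κ / (n : ℝ) ^ κ * ((n : ℝ) ^ κ / n) = PiProd n κ / n := by field_simp
  rw [e]
  gcongr
  linarith

variable {P : Matrix (Fin 2) (Fin 2) ℝ} {p ξ : Fin 2 → ℝ} {s lam : ℝ}
  {Ω : Type*} [MeasurableSpace Ω] {μ : Measure Ω} [IsProbabilityMeasure μ]
  {c₀ : Fin 3 → ℝ} {C : ℕ → Ω → Fin 3 → ℝ} {X : ℕ → Ω → Fin 3}

theorem replacementMatrix_mulVec_first :
    replacementMatrix s p P *ᵥ ![1, 0, 0] = s • ![1, 0, 0] := by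
  funext i
  fin_cases i <;> simp [replacementMatrix, mulVec, dotProduct, Fin.sum_univ_three]

/-- The conditional variance of a draw converges in mean to `-(ξ 0 * ξ 1)`, the variance of `ξ`
under the stationary distribution. -/
theorem tendsto_integral_abs_drawVariance_sub
    (h : IsUrnProcess μ (replacementMatrix s p P) c₀ C X)
    (hR : replacementMatrix s p P ∈ rowStochastic ℝ (Fin 3)) (hc : c₀ ∈ stdSimplex ℝ (Fin 3))
    (hs0 : 0 < s) (hs1 : s < 1)
    (hz : Tendsto (fun n => ∫ ω, (proportion C n ω ⬝ᵥ vTwo s p lam ξ) ^ 2 ∂μ) atTop (𝓝 0)) :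
    Tendsto (fun n => ∫ ω, |drawVariance C (vTwo s p lam ξ) n ω - -(ξ 0 * ξ 1)| ∂μ) atTop
      (𝓝 0) := by
  set v := vTwo s p lam ξ with hvdef
  have hv1 : v 1 = ξ 0 := rfl
  have hv2 : v 2 = ξ 1 := rfl
  -- The value at v 0 of (x - ξ 0)(x - ξ 1), which vanishes at v 1 and v 2; only the first colour's
  -- share obstructs the affine formula for v².
  set γ : ℝ := v 0 ^ 2 + ξ 0 * ξ 1 - (ξ 0 + ξ 1) * v 0 with hγ
  have iz : ∀ n, Integrable (fun ω => proportion C n ω ⬝ᵥ v) μ := fun n => by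
    simp only [proportion_dotProduct]
    exact (h.integrable_dotProduct hR hc n v).div_const _
  have iz2 : ∀ n, Integrable (fun ω => (proportion C n ω ⬝ᵥ v) ^ 2) μ := fun n => by
    simp only [proportion_dotProduct, div_pow]
    exact (h.integrable_dotProduct_sq hR hc n v).div_const _
  have ix : ∀ n, Integrable (fun ω => proportion C n ω ⬝ᵥ ![1, 0, 0]) μ := fun n => by
    simp only [proportion_dotProduct]
    exact (h.integrable_dotProduct hR hc n _).div_const _
  have hx : Tendsto (fun n => ∫ ω, proportion C n ω ⬝ᵥ ![1, 0, 0] ∂μ) atTop (𝓝 0) := by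
    have := (tendsto_PiProd_div_nat_add_one hs0 hs1).mul_const (c₀ ⬝ᵥ ![1, 0, 0])
    rw [zero_mul] at this
    refine this.congr fun n => ?_
    simp only [proportion_dotProduct]
    rw [integral_div, h.integral_dotProduct_eigenvector hR hc replacementMatrix_mulVec_first]
    ring
  have habs : Tendsto (fun n => ∫ ω, |proportion C n ω ⬝ᵥ v| ∂μ) atTop (𝓝 0) := by
    have hsq : Tendsto (fun n => √(∫ ω, (proportion C n ω ⬝ᵥ v) ^ 2 ∂μ)) atTop (𝓝 0) := by
      have := (Real.continuous_sqrt.tendsto 0).comp hz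
      rwa [Real.sqrt_zero] at this
    exact squeeze_zero (fun n => integral_nonneg fun ω => abs_nonneg _)
      (fun n => Real.le_sqrt_of_sq_le (sq_integral_abs_le (iz n) (iz2 n))) hsq
  have hlim := ((habs.const_mul |ξ 0 + ξ 1|).add (hx.const_mul |γ|)).add hz
  rw [mul_zero, mul_zero, add_zero, add_zero] at hlim
  refine squeeze_zero (fun n => integral_nonneg fun ω => abs_nonneg _) (fun n => ?_) hlim
  have isum : Integrable (fun ω => |ξ 0 + ξ 1| * |proportion C n ω ⬝ᵥ v|
      + |γ| * (proportion C n ω ⬝ᵥ ![1, 0, 0])) μ :=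
    ((iz n).abs.const_mul _).add ((ix n).const_mul _)
  rw [← integral_const_mul, ← integral_const_mul,
    ← integral_add ((iz n).abs.const_mul _) ((ix n).const_mul _), ← integral_add isum (iz2 n)]
  refine integral_mono (((h.integrable_drawVariance hR hc n v).sub (integrable_const _)).abs)
    (isum.add (iz2 n)) fun ω => ?_
  have hm := h.proportion_mem hR hc n ω
  have hx0 : proportion C n ω ⬝ᵥ ![1, 0, 0] = proportion C n ω 0 := by
    simp [dotProduct, Fin.sum_univ_three]
  have hsum := hm.2
  rw [Fin.sum_univ_three] at hsum
  have e : drawVariance C v n ω - -(ξ 0 * ξ 1) = (ξ 0 + ξ 1) * (proportion C n ω ⬝ᵥ v)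
      + γ * proportion C n ω 0 - (proportion C n ω ⬝ᵥ v) ^ 2 := by
    have hzdef : proportion C n ω ⬝ᵥ v = proportion C n ω 0 * v 0 + proportion C n ω 1 * ξ 0
        + proportion C n ω 2 * ξ 1 := by
      rw [dotProduct, Fin.sum_univ_three, hv1, hv2]
    rw [drawVariance, Fin.sum_univ_three, hv1, hv2, hzdef, hγ]
    linear_combination (-(ξ 0 * ξ 1)) * hsum
  simp only [e, hx0]
  refine (abs_sub _ _).trans ?_
  rw [abs_of_nonneg (sq_nonneg (proportion C n ω ⬝ᵥ v))]
  refine add_le_add ((abs_add_le _ _).trans (le_of_eq ?_)) le_rfl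
  rw [abs_mul, abs_mul, abs_of_nonneg (hm.1 0)]

/-- After two trials every colour of the dominant block is present with positive probability. -/
theorem integral_composition_two_ne_zero
    (h : IsUrnProcess μ (replacementMatrix s p P) c₀ C X)
    (hR : replacementMatrix s p P ∈ rowStochastic ℝ (Fin 3)) (hc : c₀ ∈ stdSimplex ℝ (Fin 3))
    (hs0 : 0 < s) (hs1 : s < 1) (hp : p ∈ stdSimplex ℝ (Fin 2))
    (hP : P ∈ rowStochastic ℝ (Fin 2)) (hPirr : P.IsIrreducible) :
    ∫ ω, C 2 ω 1 ∂μ ≠ 0 ∧ ∫ ω, C 2 ω 2 ∂μ ≠ 0 := by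
  have hm2 : ∀ u : Fin 3 → ℝ, ∫ ω, C 2 ω ⬝ᵥ u ∂μ = c₀ ⬝ᵥ u
      + 3 / 2 * (c₀ ⬝ᵥ (replacementMatrix s p P *ᵥ u))
      -- The mean of C 2 is c₀ (I + R)(I + R/2).
      + 1 / 2 * (c₀ ⬝ᵥ (replacementMatrix s p P *ᵥ (replacementMatrix s p P *ᵥ u))) := fun u => by
    have h0 : ∀ u : Fin 3 → ℝ, ∫ ω, C 0 ω ⬝ᵥ u ∂μ = c₀ ⬝ᵥ u := fun u => by simp [h.init]
    have h1 : ∀ u : Fin 3 → ℝ, ∫ ω, C 1 ω ⬝ᵥ u ∂μ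
        = c₀ ⬝ᵥ u + c₀ ⬝ᵥ (replacementMatrix s p P *ᵥ u) := fun u => by
      rw [h.integral_dotProduct_succ hR hc 0 u, h0, h0]; simp
    rw [h.integral_dotProduct_succ hR hc 1 u, h1, h1]
    push_cast
    ring
  have e1 : ∀ ω, C 2 ω 1 = C 2 ω ⬝ᵥ ![0, 1, 0] := fun ω => by
    simp [dotProduct, Fin.sum_univ_three]
  have e2 : ∀ ω, C 2 ω 2 = C 2 ω ⬝ᵥ ![0, 0, 1] := fun ω => by
    simp [dotProduct, Fin.sum_univ_three]
  -- Here a, b, c are the initial weights of the first, target and other colour, so both targets are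
  -- covered by symmetry. Two trials are needed when all weight is on the first colour and p charges
  -- only the other one: the term a(1-s)r y is then the way in.
  have pos : ∀ {a b c q r x y z w : ℝ}, 0 ≤ a → 0 ≤ b → 0 ≤ c → a + b + c = 1 → 0 ≤ q → 0 ≤ r →
      q + r = 1 → 0 ≤ x → 0 < y → 0 ≤ z → 0 ≤ w →
      0 < b + 3 / 2 * (a * ((1 - s) * q) + b * x + c * y) + 1 / 2 *
        (a * (s * ((1 - s) * q) + (1 - s) * q * x + (1 - s) * r * y) + b * z + c * w) := by
    intro a b c q r x y z w ha hb hc hsum hq hr hqr hx hy hz hw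
    have hs' : 0 < 1 - s := by linarith
    have t1 : 0 ≤ a * ((1 - s) * q) := by positivity
    have t2 : 0 ≤ a * (s * ((1 - s) * q) + (1 - s) * q * x) := by positivity
    have t3 : 0 ≤ a * ((1 - s) * r * y) := by positivity
    have t4 : 0 ≤ b * x := by positivity
    have t5 : 0 ≤ c * y := by positivity
    have t6 : 0 ≤ b * z := by positivity
    have t7 : 0 ≤ c * w := by positivity
    by_contra hneg
    have b0 : b = 0 := by linarith
    have c0 : c = 0 := by
      have : c * y = 0 := by linarith
      exact (mul_eq_zero.1 this).resolve_right hy.ne'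
    have a1 : a = 1 := by linarith
    have q0 : q = 0 := by
      have : a * ((1 - s) * q) = 0 := by linarith
      rw [a1, one_mul] at this
      exact (mul_eq_zero.1 this).resolve_left hs'.ne'
    have r1 : r = 1 := by linarith
    have : 0 < a * ((1 - s) * r * y) := by rw [a1, r1]; positivity
    linarith
  have hcs := hc.2
  have hps := hp.2
  rw [Fin.sum_univ_three] at hcs
  rw [Fin.sum_univ_two] at hps
  have nn := fun i j => nonneg_of_mem_rowStochastic hP (i := i) (j := j)
  constructor
  · simp only [e1]
    rw [hm2]
    refine (lt_of_lt_of_eq (pos (hc.1 0) (hc.1 1) (hc.1 2) hcs (hp.1 0) (hp.1 1) hps (nn 0 0)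
      (pos_one_zero_of_isIrreducible hPirr)
      (z := P 0 0 * P 0 0 + P 0 1 * P 1 0) (w := P 1 0 * P 0 0 + P 1 1 * P 1 0)
      (add_nonneg (mul_nonneg (nn _ _) (nn _ _)) (mul_nonneg (nn _ _) (nn _ _)))
      (add_nonneg (mul_nonneg (nn _ _) (nn _ _)) (mul_nonneg (nn _ _) (nn _ _)))) ?_).ne'
    simp [replacementMatrix, mulVec, dotProduct, Fin.sum_univ_three]
  · simp only [e2]
    rw [hm2]
    refine (lt_of_lt_of_eq (pos (hc.1 0) (hc.1 2) (hc.1 1) (by linarith) (hp.1 1) (hp.1 0)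
      (by linarith) (nn 1 1) (pos_zero_one_of_isIrreducible hPirr)
      (z := P 1 0 * P 0 1 + P 1 1 * P 1 1) (w := P 0 0 * P 0 1 + P 0 1 * P 1 1)
      (add_nonneg (mul_nonneg (nn _ _) (nn _ _)) (mul_nonneg (nn _ _) (nn _ _)))
      (add_nonneg (mul_nonneg (nn _ _) (nn _ _)) (mul_nonneg (nn _ _) (nn _ _)))) ?_).ne'
    simp [replacementMatrix, mulVec, dotProduct, Fin.sum_univ_three]
    ring

theorem tendsto_nat_div_sq : Tendsto (fun n : ℕ => (n : ℝ) / ((n : ℝ) + 1) ^ 2) atTop (𝓝 0) := by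
  refine squeeze_zero (fun n => by positivity) (fun n => ?_) tendsto_one_div_nat_add_one
  rw [div_le_div_iff₀ (by positivity) (by positivity)]
  nlinarith [(Nat.cast_nonneg n : (0 : ℝ) ≤ n)]

theorem tendsto_nat_mul_log_div_sq :
    Tendsto (fun n : ℕ => (n : ℝ) * Real.log n / ((n : ℝ) + 1) ^ 2) atTop (𝓝 0) := by
  refine squeeze_zero' (g := fun n : ℕ => Real.log n / (n : ℝ)) ?_ ?_ tendsto_log_div_nat
  · exact Eventually.of_forall fun n => by
      have := Real.log_natCast_nonneg n
      positivity
  · filter_upwards [eventually_gt_atTop 0] with n hn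
    have hn' : (0 : ℝ) < n := by exact_mod_cast hn
    have := Real.log_natCast_nonneg n
    rw [div_le_div_iff₀ (by positivity) hn']
    have h2 : (n : ℝ) * n ≤ ((n : ℝ) + 1) ^ 2 := by nlinarith
    have := mul_le_mul_of_nonneg_left h2 this
    linarith

end

end ReducibleUrn

theorem theorem4p1
    (s : ℝ) (hs0 : 0 < s) (hs1 : s < 1)
    (p : Fin 2 → ℝ) (hp : p ∈ stdSimplex ℝ (Fin 2))
    (P : Matrix (Fin 2) (Fin 2) ℝ) (hP : P ∈ rowStochastic ℝ (Fin 2)) (hPirr : P.IsIrreducible)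
    (π : Fin 2 → ℝ) (hπ : π ∈ stdSimplex ℝ (Fin 2)) (hπP : π ᵥ* P = π)
    (lam : ℝ) (hlam : lam ≠ 1) (ξ : Fin 2 → ℝ) (hξ0 : ξ ≠ 0) (hξ : P *ᵥ ξ = lam • ξ)
    (hR : ReducibleUrn.IsDiagonalizable (ReducibleUrn.replacementMatrix s p P))
    (c₀ : Fin 3 → ℝ) (hc₀ : c₀ ∈ stdSimplex ℝ (Fin 3))
    {Ω : Type*} [MeasurableSpace Ω] (μ : Measure Ω) [IsProbabilityMeasure μ]
    (C : ℕ → Ω → Fin 3 → ℝ) (X : ℕ → Ω → Fin 3)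
    (hC : ReducibleUrn.IsUrnProcess μ (ReducibleUrn.replacementMatrix s p P) c₀ C X) :
    (lam < 1 / 2 →
      ReducibleUrn.ConvergesWeaklyToNormal μ
        (fun n ω => (C n ω ⬝ᵥ ReducibleUrn.vTwo s p lam ξ) / √(n : ℝ))
        (lam ^ 2 / (1 - 2 * lam) * (π ⬝ᵥ ξ ^ 2)).toNNReal) ∧
    (lam = 1 / 2 →
      ReducibleUrn.ConvergesWeaklyToNormal μ
        (fun n ω => (C n ω ⬝ᵥ ReducibleUrn.vTwo s p lam ξ) / √((n : ℝ) * Real.log n))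
        (lam ^ 2 * (π ⬝ᵥ ξ ^ 2)).toNNReal) ∧
    (1 / 2 < lam →
      (Martingale
          (fun n ω => (C n ω ⬝ᵥ ReducibleUrn.vTwo s p lam ξ) / ReducibleUrn.PiProd n lam)
          hC.filtration μ ∧
        ∃ B : ℝ≥0, ∀ n : ℕ,
          eLpNorm (fun ω => (C n ω ⬝ᵥ ReducibleUrn.vTwo s p lam ξ) / ReducibleUrn.PiProd n lam)
            2 μ ≤ B) ∧
      ∃ V : Ω → ℝ, Measurable V ∧ ReducibleUrn.NonDegenerate μ V ∧
        ∀ᵐ ω ∂μ, Tendsto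
          (fun n : ℕ => (C n ω ⬝ᵥ ReducibleUrn.vTwo s p lam ξ) / (n : ℝ) ^ lam)
          atTop (𝓝 (V ω))) := by
  have hRs := ReducibleUrn.replacementMatrix_mem_rowStochastic hs0 hs1 hp hP
  have hv := ReducibleUrn.replacementMatrix_mulVec_vTwo hs1 hP hPirr hξ0 hξ hR
  have hl := ReducibleUrn.neg_one_le_eigenvalue hP hξ hlam hξ0
  have hvar := ReducibleUrn.stationary_dotProduct_sq hπ
    (ReducibleUrn.stationary_dotProduct_eigenvector hπP hξ hlam)
  have hvar0 : 0 ≤ π ⬝ᵥ ξ ^ 2 := by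
    refine Finset.sum_nonneg fun i _ => mul_nonneg (hπ.1 i) ?_
    exact sq_nonneg (ξ i)
  refine ⟨fun h12 => ?_, fun h12 => ?_, fun h12 => ⟨⟨?_, ?_⟩, ?_⟩⟩
  -- λ may be negative or zero; any κ ≥ λ with 0 < κ < 1/2 gives Π_n(κ) = o(√n).
  · have hκ0 : 0 < max lam (1 / 4) := lt_max_of_lt_right (by norm_num)
    have hq := ReducibleUrn.tendsto_PiProd_div_sqrt hκ0 (max_lt h12 (by norm_num))
    have hw : ∀ᶠ n : ℕ in atTop, (0 : ℝ) < n := by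
      filter_upwards [eventually_gt_atTop 0] with n hn
      exact_mod_cast hn
    have hη : 0 < 1 - 2 * lam := by linarith
    have hsrc := ReducibleUrn.tendsto_linear_source lam
    refine hC.convergesWeaklyToNormal hRs hc₀ hv hl hκ0.le (le_max_left _ _) hw hsrc hη hq hvar0 ?_
    rw [hvar]
    exact ReducibleUrn.tendsto_integral_abs_drawVariance_sub hC hRs hc₀ hs0 hs1
      (hC.tendsto_integral_proportion_sq hRs hc₀ hv hl hκ0.le (le_max_left _ _) hw hsrc hη hq
        ReducibleUrn.tendsto_nat_div_sq)
  -- Here κ = λ = 1/2 is admissible, since √(log n) beats Π_n(1/2) ~ const · √n.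
  · have hq := ReducibleUrn.tendsto_PiProd_half_div_sqrt
    have hw : ∀ᶠ n : ℕ in atTop, (0 : ℝ) < n * Real.log n := by
      filter_upwards [eventually_gt_atTop 1] with n hn
      have hn' : (1 : ℝ) < n := by exact_mod_cast hn
      have := Real.log_pos hn'
      positivity
    have hsrc := ReducibleUrn.tendsto_mul_log_source
    rw [← h12] at hq hsrc
    have hκ0 : 0 ≤ lam := by rw [h12]; norm_num
    have := hC.convergesWeaklyToNormal hRs hc₀ hv hl hκ0 le_rfl hw hsrc one_pos hq hvar0 (by
      rw [hvar]
      exact ReducibleUrn.tendsto_integral_abs_drawVariance_sub hC hRs hc₀ hs0 hs1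
        (hC.tendsto_integral_proportion_sq hRs hc₀ hv hl hκ0 le_rfl hw hsrc one_pos hq
          ReducibleUrn.tendsto_nat_mul_log_div_sq))
    rwa [div_one] at this
  · exact hC.martingale_dotProduct_div_PiProd hRs hc₀ hv (by linarith)
  · exact hC.exists_eLpNorm_two_le hRs hc₀ hv h12
  · obtain ⟨h1, h2⟩ := ReducibleUrn.integral_composition_two_ne_zero hC hRs hc₀ hs0 hs1 hp hP hPirr
    exact hC.exists_nonDegenerate_limit hRs hc₀ hv h12 (m := 2) (i := 1) (j := 2)
      (ReducibleUrn.eigen_ne hP hξ hlam hξ0) h1 h2
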